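/- An instance of MEFE-Matching consists of a finite set $X$ of courses, a finite set $T$ of teaching assistants (TAs), utilities $v_x\colon T\to\mathbb{Z}_{\ge 0}$ of the courses $x\in X$, utilities $u_t\colon X\to\mathbb{Z}_{\ge 0}$ and grades $g_t\colon X\to\mathbb{Q}_{\ge 0}$ of the TAs $t\in T$, capacities $c_x\in\mathbb{Z}_{>0}$ of the courses, and a threshold $k\in\mathbb{Q}_{\ge 0}$, where $v_x(t)=0$ if and only if $u_t(x)=0$. A matching is a map $\mu\colon T\to X\cup\{\emptyset\}$; put $u_t(\emptyset)=0$. It is a MEFE matching if 1. $|\mu^{-1}(x)|=c_x$ for every course $x$, and $u_t(\mu(t))>0$ whenever $\mu(t)\neq\emptyset$; 2. $\frac{1}{c_x}\sum_{t\in\mu^{-1}(x)}v_x(t)\ge k$ for every course $x$; 3. there are no TAs $t,t'$ with $\mu(t')\ne\emptyset$, $g_t(\mu(t'))\ge g_{t'}(\mu(t'))$ and $u_t(\mu(t'))>u_t(\mu(t))$. MEFE-Matching asks to find a MEFE matching of a given instance or to report that none exists. Theorem. MEFE-Matching can be solved in time polynomial in the size of the instance (all numbers written in binary) on the instances in which every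 course has at most two distinct positive valuations, i.e. $|\{v_x(t): t\in T\}\setminus\{0\}|\le 2$ for all $x\in X$; no two TAs have the same grade in a course, i.e. $g_t(x)\neq g_{t'}(x)$ for all $x\in X$ and all $t\neq t'$ in $T$; and each TA has distinct valuations for the courses it values positively, i.e. $u_t(x)\ne u_t(x')$ whenever $x\neq x'$ and $u_t(x),u_t(x')>0$. -/

import Mathlib

/-!  Model of computation: imperative programs over a random access memory of natural numbers,
with the logarithmic cost measure (every operation is charged the bit lengths of its operands,
of the addresses it uses, and of the values it moves).  -/

namespace RAM

/-- The memory: finitely many arrays are used by a given program (array names occur in programs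
only as constants); each array is indexed by natural numbers, and each cell holds a natural
number. -/
abbrev Mem : Type := ℕ → ℕ → ℕ

/-- The arithmetic operations; `sub` is truncated subtraction. -/
inductive Op : Type where
  | add : Op
  | sub : Op
  | mul : Op

def Op.eval : Op → ℕ → ℕ → ℕ
  | .add, x, y => x + y
  | .sub, x, y => x - y
  | .mul, x, y => x * y

/-- Expressions: constants, the content of cell `e` of array `a`, arithmetic. -/
inductive Expr : Type where
  | const (n : ℕ) : Expr
  | get (a : ℕ) (e : Expr) : Expr
  | bin (o : Op) (e₁ e₂ : Expr) : Expr

def Expr.eval (s : Mem) : Expr → ℕ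
  | .const n => n
  | .get a e => s a (e.eval s)
  | .bin o e₁ e₂ => o.eval (e₁.eval s) (e₂.eval s)

/-- Logarithmic cost of evaluating an expression (`Nat.size` is the length in binary). -/
def Expr.cost (s : Mem) : Expr → ℕ
  | .const n => Nat.size n + 1
  | .get a e => e.cost s + Nat.size (e.eval s) + Nat.size (s a (e.eval s)) + 1
  | .bin _ e₁ e₂ => e₁.cost s + e₂.cost s + Nat.size (e₁.eval s) + Nat.size (e₂.eval s) + 1

/-- Programs.  `set a e₁ e₂` is the assignment `a[e₁] := e₂`; `cond` and `loop` test whether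
an expression is nonzero. -/
inductive Prog : Type where
  | skip : Prog
  | set (a : ℕ) (e₁ e₂ : Expr) : Prog
  | seq (P Q : Prog) : Prog
  | cond (e : Expr) (P Q : Prog) : Prog
  | loop (e : Expr) (P : Prog) : Prog

/-- The memory after writing `x` to cell `i` of array `a`. -/
def Mem.write (s : Mem) (a i x : ℕ) : Mem :=
  Function.update s a (Function.update (s a) i x)

/-- `Exec P s c s'`: program `P`, started in memory `s`, halts with memory `s'` at total
logarithmic cost `c`. -/
inductive Exec : Prog → Mem → ℕ → Mem → Prop where
  | skip (s : Mem) : Exec .skip s 1 s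
  | set (s : Mem) (a : ℕ) (e₁ e₂ : Expr) :
      Exec (.set a e₁ e₂) s
        (e₁.cost s + e₂.cost s + Nat.size (e₁.eval s) + Nat.size (e₂.eval s) + 1)
        (s.write a (e₁.eval s) (e₂.eval s))
  | seq {P Q : Prog} {s s₁ s₂ : Mem} {c₁ c₂ : ℕ} (h₁ : Exec P s c₁ s₁) (h₂ : Exec Q s₁ c₂ s₂) :
      Exec (.seq P Q) s (c₁ + c₂) s₂
  | cond_true {e : Expr} {P Q : Prog} {s s₁ : Mem} {c : ℕ} (he : e.eval s ≠ 0)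
      (h : Exec P s c s₁) :
      Exec (.cond e P Q) s (e.cost s + Nat.size (e.eval s) + 1 + c) s₁
  | cond_false {e : Expr} {P Q : Prog} {s s₁ : Mem} {c : ℕ} (he : e.eval s = 0)
      (h : Exec Q s c s₁) :
      Exec (.cond e P Q) s (e.cost s + Nat.size (e.eval s) + 1 + c) s₁
  | loop_done {e : Expr} {P : Prog} {s : Mem} (he : e.eval s = 0) :
      Exec (.loop e P) s (e.cost s + Nat.size (e.eval s) + 1) s
  | loop_step {e : Expr} {P : Prog} {s s₁ s₂ : Mem} {c₁ c₂ : ℕ} (he : e.eval s ≠ 0)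
      (h₁ : Exec P s c₁ s₁) (h₂ : Exec (.loop e P) s₁ c₂ s₂) :
      Exec (.loop e P) s (e.cost s + Nat.size (e.eval s) + 1 + c₁ + c₂) s₂

/-- The initial memory on input `l`: array `0` holds the length of `l` in cell `0` and then the
entries of `l`; all other cells are `0`. -/
def load (l : List ℕ) : Mem :=
  fun a i => if a = 0 then (l.length :: l).getD i 0 else 0

/-- The memory `s` presents the output `l`: array `1` holds the length of `l` in cell `0` and
then the entries of `l`. -/
def Outputs (s : Mem) (l : List ℕ) : Prop :=
  ∀ i, i ≤ l.length → s 1 i = (l.length :: l).getD i 0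

/-- Size of an input: the number of bits of its entries written in binary, one separator each. -/
def inputSize (l : List ℕ) : ℕ := (l.map fun x => Nat.size x + 1).sum

/-- `P` halts on input `l` with output `r` at cost at most `b`. -/
def RunsWithin (P : Prog) (l r : List ℕ) (b : ℕ) : Prop :=
  ∃ (c : ℕ) (s : Mem), Exec P (load l) c s ∧ c ≤ b ∧ Outputs s r

/-- The search problem "given an instance `x` in the class `D`, find a `y` with `Sol x y`, or
report that there is none" is solvable in polynomial time.  `inp` encodes the instances and `out`
the candidate solutions.  The output is `1` followed by the encoding of a solution,
or just `0` for "no". -/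
def PolyTimeSolvable {α : Type} {β : α → Type} (inp : α → List ℕ) (out : ∀ x, β x → List ℕ)
    (D : α → Prop) (Sol : ∀ x, β x → Prop) : Prop :=
  ∃ (P : Prog) (p : Polynomial ℕ), ∀ x, D x →
    (∃ y, Sol x y ∧ RunsWithin P (inp x) (1 :: out x y) (p.eval (inputSize (inp x)))) ∨
    ((¬ ∃ y, Sol x y) ∧ RunsWithin P (inp x) [0] (p.eval (inputSize (inp x))))

end RAM

namespace MEFE

/-- An instance: `n` courses, `m` teaching assistants (TAs). -/
structure Inst : Type where
  n : ℕ
  m : ℕ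
  /-- `v x t` is the utility of course `x` for TA `t` -/
  v : Fin n → Fin m → ℕ
  /-- `u t x` is the utility of TA `t` for course `x` -/
  u : Fin m → Fin n → ℕ
  /-- `g t x` is the grade of TA `t` in course `x` -/
  g : Fin m → Fin n → NNRat
  /-- `c x` is the capacity of course `x`, the number of TAs it requires -/
  c : Fin n → ℕ
  /-- the satisfaction threshold -/
  k : NNRat
  c_pos : ∀ x, 0 < c x
  /-- a course values a TA at zero exactly if the TA values the course at zero -/
  zero_iff : ∀ x t, v x t = 0 ↔ u t x = 0

namespace Inst

variable (I : Inst)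

/-- A matching assigns to each TA a course or nothing. -/
abbrev Matching : Type := Fin I.m → Option (Fin I.n)

/-- The set of TAs assigned to course `x`. -/
def assigned (μ : I.Matching) (x : Fin I.n) : Finset (Fin I.m) :=
  Finset.univ.filter fun t => μ t = some x

/-- Every course gets as many TAs as it requires, no TA is assigned to a course of value zero. -/
def Feasible (μ : I.Matching) : Prop :=
  (∀ x, (I.assigned μ x).card = I.c x) ∧ ∀ t x, μ t = some x → I.u t x ≠ 0

def avgUtil (μ : I.Matching) (x : Fin I.n) : ℚ :=
  ((∑ t ∈ I.assigned μ x, I.v x t : ℕ) : ℚ) / (I.c x : ℚ)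

/-- Utility of TA `t` for an assignment; being unassigned has utility `0`. -/
def util (t : Fin I.m) : Option (Fin I.n) → ℕ
  | none => 0
  | some x => I.u t x

/-- TA `t` envies TA `t'` on merit basis. -/
def Envies (μ : I.Matching) (t t' : Fin I.m) : Prop :=
  ∃ x, μ t' = some x ∧ I.g t' x ≤ I.g t x ∧ I.util t (μ t) < I.util t (μ t')

/-- Fair (merit-based envy-free egalitarian) matchings. -/
structure Fair (μ : I.Matching) : Prop where
  feasible : I.Feasible μ
  satisfied : ∀ x, (I.k : ℚ) ≤ I.avgUtil μ x
  envy_free : ∀ t t', ¬ I.Envies μ t t'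

/-- The number of distinct positive values that course `x` assigns to TAs. -/
def valuationTypes (x : Fin I.n) : ℕ :=
  ((Finset.univ.image (I.v x)).filter fun q => 0 < q).card

/-- The restricted class: every course has at most two distinct positive valuations, no two TAs
have the same grade in a course, and no TA has the same value for two courses that it values
positively. -/
structure Restricted : Prop where
  two_values : ∀ x, I.valuationTypes x ≤ 2
  grades : ∀ x t t', t ≠ t' → I.g t x ≠ I.g t' x
  strict : ∀ t x x', x ≠ x' → 0 < I.u t x → 0 < I.u t x' → I.u t x ≠ I.u t x'

/-- The entries of a matrix, row by row. -/
def rows {a b : ℕ} (f : Fin a → Fin b → ℕ) : List ℕ :=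
  (List.ofFn fun i => List.ofFn (f i)).flatten

/-- Encoding of an instance: all its numbers, rationals by numerator and denominator, and the list
of the TAs (so that the size of an instance is at least the number of its TAs, also when there are
no courses). -/
def encode : List ℕ :=
  [I.n, I.m, I.k.num, I.k.den] ++ List.ofFn I.c ++ rows I.v ++ rows I.u ++
    rows (fun t x => (I.g t x).num) ++ rows (fun t x => (I.g t x).den) ++ List.range I.m

/-- Encoding of a matching: for each TA, `0` if unassigned, else `1` plus the index of its
course. -/
def encodeMatching (μ : I.Matching) : List ℕ :=
  List.ofFn fun t => match μ t with
    | none => 0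
    | some x => (x : ℕ) + 1

end Inst

end MEFE

/-! The algorithm is a deferred acceptance procedure. It maintains a matching `μ` in which every TA
is at least as well off as in any fair matching (`Dominates`), starting from everybody's best
course. A TA `t` at `x` moves to its best course of smaller utility once no fair matching can give
`x` to `t`. Evidence for this (`Rejects`) comes in two kinds. Either a TA with at least the grade of
`t` in `x` prefers `x` to its course in `μ`, hence to its course in any fair matching, and would
envy `t`. Or `x` holds at least `c x` TAs, too many or of too small total value, and `t` has the
lowest grade among them. A fair matching with `t` at `x` would then miss another TA of `x`; by
strictness that TA would be worse off than at `x`, and would envy `t` (`Restricted.ne_of_rejects`).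

Each move shrinks a potential that is at most `n * m`. When nobody has to leave, no course exceeds
its capacity, and the matching is fair if it employs `∑ x, I.c x` TAs (`Dominates.fair`). By
domination it employs at least as many TAs as any fair matching, so falling short proves that none
exists (`Fair.sum_c_le_matched`).

For the running time, the program uses only loops of `n` or `m` passes and stores no products. Bit
lengths therefore grow by a polynomial amount and the logarithmic cost is polynomial
(`Tame.exists_growth`, `Tame.exists_cost`). -/

namespace RAM

/-! ### Structured programs with counted loops -/

theorem Mem.write_same (s : Mem) (a i x : ℕ) : s.write a i x a = Function.update (s a) i x := by
  simp [Mem.write]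

theorem Mem.write_of_ne (s : Mem) {a b : ℕ} (i x : ℕ) (h : b ≠ a) : s.write a i x b = s b := by
  simp [Mem.write, h]

/-- Structured programs: assignment, sequence, conditional, and `rep a b P`, which repeats `P` with
counter `a[0]` running from `0` up to the content of cell `b` of the input array. -/
inductive Cmd : Type where
  | skip : Cmd
  | set (a : ℕ) (e₁ e₂ : Expr) : Cmd
  | seq (P Q : Cmd) : Cmd
  | cond (e : Expr) (P Q : Cmd) : Cmd
  | rep (a b : ℕ) (P : Cmd) : Cmd

namespace Cmd

def toProg : Cmd → Prog
  | skip => .skip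
  | set a e₁ e₂ => .set a e₁ e₂
  | seq P Q => .seq P.toProg Q.toProg
  | cond e P Q => .cond e P.toProg Q.toProg
  | rep a b P =>
    .seq (.set a (.const 0) (.const 0))
      (.loop (.bin .sub (.get 0 (.const b)) (.get a (.const 0)))
        (.seq P.toProg (.set a (.const 0) (.bin .add (.get a (.const 0)) (.const 1)))))

/-- The memory after running a structured program. -/
def run : Cmd → Mem → Mem
  | skip, s => s
  | set a e₁ e₂, s => s.write a (e₁.eval s) (e₂.eval s)
  | seq P Q, s => Q.run (P.run s)
  | cond e P Q, s => if e.eval s ≠ 0 then P.run s else Q.run s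
  | rep a b P, s =>
    (fun s => (P.run s).write a 0 (P.run s a 0 + 1))^[s 0 b] (s.write a 0 0)

/-- The arrays a program writes to. -/
def writes : Cmd → List ℕ
  | skip => []
  | set a _ _ => [a]
  | seq P Q => P.writes ++ Q.writes
  | cond _ P Q => P.writes ++ Q.writes
  | rep a _ P => a :: P.writes

/-- The frame rule; for concrete programs its side condition is settled by `decide`. -/
theorem run_of_notMem_writes (P : Cmd) (s : Mem) {d : ℕ} (h : d ∉ P.writes) :
    P.run s d = s d := by
  induction P generalizing s with
  | skip => rfl
  | set a e₁ e₂ =>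
    simp only [writes, List.mem_singleton] at h
    exact Mem.write_of_ne _ _ _ h
  | seq P Q ihP ihQ =>
    simp only [writes, List.mem_append, not_or] at h
    simp [run, ihP _ h.1, ihQ _ h.2]
  | cond e P Q ihP ihQ =>
    simp only [writes, List.mem_append, not_or] at h
    simp only [run]
    split_ifs
    exacts [ihP _ h.1, ihQ _ h.2]
  | rep a b P ih =>
    simp only [writes, List.mem_cons, not_or] at h
    simp only [run]
    generalize s 0 b = N
    induction N with
    | zero => exact Mem.write_of_ne _ _ _ h.1
    | succ N ihN =>
      rw [Function.iterate_succ_apply', Mem.write_of_ne _ _ _ h.1, ih _ h.2, ihN]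

/-- The invariant rule for `rep`. -/
theorem run_rep {a b : ℕ} {P : Cmd} {s : Mem} (Inv : ℕ → Mem → Prop) (ha : a ∉ P.writes)
    (h0 : Inv 0 (s.write a 0 0))
    (hstep : ∀ j r, j < s 0 b → r a 0 = j → Inv j r → Inv (j + 1) ((P.run r).write a 0 (j + 1))) :
    Inv (s 0 b) ((rep a b P).run s) := by
  simp only [run]
  have key : ∀ N, N ≤ s 0 b →
      (fun s => (P.run s).write a 0 (P.run s a 0 + 1))^[N] (s.write a 0 0) a 0 = N ∧
      Inv N ((fun s => (P.run s).write a 0 (P.run s a 0 + 1))^[N] (s.write a 0 0)) := by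
    intro N hN
    induction N with
    | zero => exact ⟨by simp [Mem.write_same], h0⟩
    | succ N ih =>
      obtain ⟨h1, h2⟩ := ih (by omega)
      rw [Function.iterate_succ_apply']
      have := hstep N _ (by omega) h1 h2
      rw [run_of_notMem_writes _ _ ha, h1]
      exact ⟨by simp [Mem.write_same], this⟩
  exact (key _ le_rfl).2

end Cmd

/-! ### Polynomial bounds on memory growth and cost -/

/-- Expressions without a multiplication at value level: their values are at most a constant number
of bits longer than the contents of the memory. -/
def Expr.Additive : Expr → Prop
  | .const _ => True
  | .get _ _ => True
  | .bin .add e₁ e₂ => e₁.Additive ∧ e₂.Additive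
  | .bin .sub e₁ _ => e₁.Additive
  | .bin .mul _ _ => False

/-- The input array is never written, counters are written by their own loop only,
and only values of additive expressions are stored. -/
def Cmd.Tame : Cmd → Prop
  | .skip => True
  | .set a _ e₂ => a ≠ 0 ∧ e₂.Additive
  | .seq P Q => P.Tame ∧ Q.Tame
  | .cond _ P Q => P.Tame ∧ Q.Tame
  | .rep a b P => a ≠ 0 ∧ (b = 1 ∨ b = 2) ∧ a ∉ P.writes ∧ P.Tame

/-- Every memory cell has at most `B` bits. -/
def Mem.BitsLE (s : Mem) (B : ℕ) : Prop := ∀ a i, Nat.size (s a i) ≤ B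

theorem Mem.BitsLE.mono {s : Mem} {B C : ℕ} (h : s.BitsLE B) (hBC : B ≤ C) : s.BitsLE C :=
  fun a i => (h a i).trans hBC

theorem Mem.BitsLE.write {s : Mem} {B x : ℕ} (h : s.BitsLE B) (hx : Nat.size x ≤ B) (a i : ℕ) :
    (s.write a i x).BitsLE B := by
  intro b j
  unfold Mem.write
  by_cases hb : b = a
  · subst hb
    by_cases hj : j = i
    · subst hj; simpa using hx
    · simpa [hj] using h b j
  · simpa [hb] using h b j

theorem size_add_le {x y B : ℕ} (hx : Nat.size x ≤ B) (hy : Nat.size y ≤ B) :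
    Nat.size (x + y) ≤ B + 1 := by
  rw [Nat.size_le] at *
  rw [pow_succ]; omega

theorem size_mul_le (x y : ℕ) : Nat.size (x * y) ≤ Nat.size x + Nat.size y := by
  rw [Nat.size_le, pow_add]
  exact Nat.mul_lt_mul'' (Nat.lt_size_self x) (Nat.lt_size_self y)

/-- Each operation at most adds the sizes of its operands and one bit, so a fixed expression costs a
constant factor. Products are allowed here. -/
theorem Expr.exists_cost_le (e : Expr) : ∃ K, ∀ (s : Mem) (B : ℕ), s.BitsLE B →
    Nat.size (e.eval s) ≤ K * (B + 1) ∧ e.cost s ≤ K * (B + 1) := by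
  induction e with
  | const n =>
    refine ⟨Nat.size n + 1, fun s B _ => ?_⟩
    simp only [eval, cost]
    constructor <;> nlinarith [Nat.zero_le (Nat.size n), Nat.zero_le B,
      Nat.zero_le (Nat.size n * B)]
  | get a e ih =>
    obtain ⟨K, hK⟩ := ih
    refine ⟨2 * K + 2, fun s B hs => ?_⟩
    obtain ⟨h1, h2⟩ := hK s B hs
    have h3 := hs a (e.eval s)
    simp only [eval, cost]
    constructor <;> nlinarith
  | bin o e₁ e₂ ih₁ ih₂ =>
    obtain ⟨K, hK⟩ := ih₁
    obtain ⟨L, hL⟩ := ih₂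
    refine ⟨2 * K + 2 * L + 1, fun s B hs => ?_⟩
    obtain ⟨h1, h2⟩ := hK s B hs
    obtain ⟨h3, h4⟩ := hL s B hs
    simp only [eval, cost]
    constructor
    · suffices h : Nat.size (o.eval (e₁.eval s) (e₂.eval s)) ≤
          Nat.size (e₁.eval s) + Nat.size (e₂.eval s) + 1 by nlinarith
      cases o with
      | add => exact size_add_le (by omega) (by omega)
      | sub =>
        have := Nat.size_le_size (Nat.sub_le (e₁.eval s) (e₂.eval s))
        simp only [Op.eval]; omega
      | mul =>
        have := size_mul_le (e₁.eval s) (e₂.eval s)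
        simp only [Op.eval]; omega
    · nlinarith

/-- Unlike a factor, an additive constant survives iteration: `N` passes add `N * K` bits instead of
multiplying by `K ^ N`. -/
theorem Expr.Additive.exists_size_le {e : Expr} (he : e.Additive) : ∃ K, ∀ (s : Mem) (B : ℕ),
    s.BitsLE B → Nat.size (e.eval s) ≤ B + K := by
  induction e with
  | const n => exact ⟨Nat.size n, fun s B _ => by simp [eval]⟩
  | get a e ih => exact ⟨0, fun s B hs => hs _ _⟩
  | bin o e₁ e₂ ih₁ ih₂ =>
    cases o with
    | add =>
      obtain ⟨K, hK⟩ := ih₁ he.1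
      obtain ⟨L, hL⟩ := ih₂ he.2
      refine ⟨K + L + 1, fun s B hs => ?_⟩
      have h1 := hK s B hs
      have h2 := hL s B hs
      exact (size_add_le (x := e₁.eval s) (y := e₂.eval s) (B := B + K + L) (by omega)
        (by omega)).trans (by omega)
    | sub =>
      obtain ⟨K, hK⟩ := ih₁ he
      exact ⟨K, fun s B hs => (Nat.size_le_size (Nat.sub_le _ _)).trans (hK s B hs)⟩
    | mul => exact he.elim

namespace Cmd

theorem Tame.zero_notMem_writes {P : Cmd} (h : P.Tame) : 0 ∉ P.writes := by
  induction P with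
  | skip => simp [writes]
  | set a e₁ e₂ => simpa [writes] using h.1.symm
  | seq P Q ihP ihQ => simp [writes, ihP h.1, ihQ h.2]
  | cond e P Q ihP ihQ => simp [writes, ihP h.1, ihQ h.2]
  | rep a b P ih => simp [writes, ih h.2.2.2, h.1.symm]

/-- Fixing the input array `s₀` keeps the inner loop bounds, and so the growth `g`, the same in
every pass. -/
theorem iterate_bits {f : Mem → Mem} {g : ℕ} {s₀ : ℕ → ℕ}
    (hf : ∀ s B, s 0 = s₀ → s.BitsLE B → (f s).BitsLE (B + g) ∧ f s 0 = s₀) {s : Mem} {B : ℕ}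
    (h0 : s 0 = s₀) (hs : s.BitsLE B) (N : ℕ) :
    (f^[N] s).BitsLE (B + N * g) ∧ f^[N] s 0 = s₀ := by
  induction N with
  | zero => exact ⟨by simpa using hs, h0⟩
  | succ N ih =>
    rw [Function.iterate_succ_apply']
    refine ⟨(hf _ _ ih.2 ih.1).1.mono ?_, (hf _ _ ih.2 ih.1).2⟩
    rw [add_mul]; omega

/-- The length of the memory contents grows by at most a polynomial in the loop bounds. -/
theorem Tame.exists_growth {P : Cmd} (h : P.Tame) : ∃ q : Polynomial ℕ, ∀ (s : Mem) (B z : ℕ),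
    s.BitsLE B → s 0 1 ≤ z → s 0 2 ≤ z → (P.run s).BitsLE (B + q.eval z) := by
  induction P with
  | skip => exact ⟨0, fun s B z hs _ _ => by simpa [run] using hs⟩
  | set a e₁ e₂ =>
    obtain ⟨K, hK⟩ := h.2.exists_size_le
    refine ⟨Polynomial.C K, fun s B z hs _ _ => ?_⟩
    simp only [Polynomial.eval_C, run]
    exact (hs.mono (Nat.le_add_right _ _)).write (hK s B hs) _ _
  | seq P Q ihP ihQ =>
    obtain ⟨p, hp⟩ := ihP h.1
    obtain ⟨q, hq⟩ := ihQ h.2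
    refine ⟨p + q, fun s B z hs h1 h2 => ?_⟩
    have e0 := run_of_notMem_writes P s h.1.zero_notMem_writes
    rw [Polynomial.eval_add, ← add_assoc]
    exact hq _ _ _ (hp s B z hs h1 h2) (by rwa [e0]) (by rwa [e0])
  | cond e P Q ihP ihQ =>
    obtain ⟨p, hp⟩ := ihP h.1
    obtain ⟨q, hq⟩ := ihQ h.2
    refine ⟨p + q, fun s B z hs h1 h2 => ?_⟩
    simp only [run, Polynomial.eval_add]
    split_ifs
    · exact (hp s B z hs h1 h2).mono (by omega)
    · exact (hq s B z hs h1 h2).mono (by omega)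
  | rep a b P ih =>
    obtain ⟨ha, hb, haP, hP⟩ := h
    obtain ⟨p, hp⟩ := ih hP
    -- There are at most `z` passes, each adding the growth of the body and at most two bits for the
    -- incremented counter.
    refine ⟨Polynomial.X * (p + 2), fun s B z hs h1 h2 => ?_⟩
    have hbz : s 0 b ≤ z := by rcases hb with rfl | rfl <;> assumption
    simp only [run]
    refine ((iterate_bits (s₀ := s 0) (g := p.eval z + 2) ?_ (Mem.write_of_ne _ _ _ ha.symm)
      (hs.write (by simp) _ _) (s 0 b)).1).mono ?_
    · intro r C h0 hr
      have hr' := hp r C z hr (by rwa [h0]) (by rwa [h0])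
      refine ⟨(hr'.mono (by omega)).write ?_ _ _, ?_⟩
      · exact (size_add_le (B := C + p.eval z + 1) ((hr' a 0).trans (by omega))
          (by simp)).trans (by omega)
      · rw [Mem.write_of_ne _ _ _ ha.symm, run_of_notMem_writes _ _ hP.zero_notMem_writes, h0]
    · simp only [Polynomial.eval_mul, Polynomial.eval_X, Polynomial.eval_add, Polynomial.eval_ofNat]
      gcongr

/-- The costs `D` and `E` of body and tests are taken at the final bit bound `B₁`; `hB` says that
the remaining `k` passes stay below it. -/
theorem exec_loop {a b B₁ z g D E : ℕ} {P : Cmd} (ha : a ≠ 0) (haP : a ∉ P.writes)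
    (h0P : 0 ∉ P.writes)
    (hg : ∀ (s : Mem) (B : ℕ), s.BitsLE B → s 0 1 ≤ z → s 0 2 ≤ z → (P.run s).BitsLE (B + g))
    (hD : ∀ s : Mem, s.BitsLE B₁ → s 0 1 ≤ z → s 0 2 ≤ z →
      ∃ c ≤ D, Exec P.toProg s c (P.run s))
    (hE : ∀ s : Mem, s.BitsLE B₁ →
      (Expr.bin .sub (.get 0 (.const b)) (.get a (.const 0))).cost s +
        Nat.size ((Expr.bin .sub (.get 0 (.const b)) (.get a (.const 0))).eval s) ≤ E ∧
      (Expr.bin .add (.get a (.const 0)) (.const 1)).cost s +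
        Nat.size ((Expr.bin .add (.get a (.const 0)) (.const 1)).eval s) ≤ E)
    (k : ℕ) (r : Mem) (B : ℕ) (hr : r.BitsLE B) (hB : B + k * (g + 2) ≤ B₁)
    (h1 : r 0 1 ≤ z) (h2 : r 0 2 ≤ z) (hk : r a 0 + k = r 0 b) :
    ∃ c ≤ k * (D + 2 * E + 4) + E + 1,
      Exec (.loop (.bin .sub (.get 0 (.const b)) (.get a (.const 0)))
        (.seq P.toProg (.set a (.const 0) (.bin .add (.get a (.const 0)) (.const 1))))) r c
        ((fun s => (P.run s).write a 0 (P.run s a 0 + 1))^[k] r) := by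
  induction k generalizing r B with
  | zero =>
    refine ⟨_, ?_, Exec.loop_done ?_⟩
    · have := (hE r (hr.mono (by omega))).1
      omega
    · simp only [Expr.eval, Op.eval]; omega
  | succ k ih =>
    rw [add_mul] at hB
    have e0 := run_of_notMem_writes P r h0P
    have ea := run_of_notMem_writes P r haP
    obtain ⟨c, hc, hex⟩ := hD r (hr.mono (by omega)) h1 h2
    have hr' := hg r B hr h1 h2
    have hw : ((P.run r).write a 0 (P.run r a 0 + 1)).BitsLE (B + (g + 2)) :=
      (hr'.mono (by omega)).write ((size_add_le (B := B + g + 1) ((hr' a 0).trans (by omega))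
        (by simp)).trans (by omega)) _ _
    have ew : (P.run r).write a 0 (P.run r a 0 + 1) 0 = r 0 := by
      rw [Mem.write_of_ne _ _ _ ha.symm, e0]
    obtain ⟨d, hd, hloop⟩ := ih _ _ hw (by omega) (by rwa [ew]) (by rwa [ew])
      (by rw [ew, Mem.write_same, ea]; simp only [Function.update_self]; omega)
    have hset := Exec.set (P.run r) a (.const 0) (.bin .add (.get a (.const 0)) (.const 1))
    refine ⟨_, ?_, Exec.loop_step (by simp only [Expr.eval, Op.eval]; omega)
      (Exec.seq hex hset) hloop⟩
    have t1 := (hE r (hr.mono (by omega))).1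
    have t2 := (hE (P.run r) (hr'.mono (by omega))).2
    have t3 : (Expr.const 0).cost (P.run r) = 1 := by simp [Expr.cost]
    have t4 : Nat.size ((Expr.const 0).eval (P.run r)) = 0 := by simp [Expr.eval]
    rw [add_mul]
    omega

/-- Tame programs run in polynomial time. -/
theorem Tame.exists_cost {P : Cmd} (h : P.Tame) (q : Polynomial ℕ) :
    ∃ p : Polynomial ℕ, ∀ (s : Mem) (z : ℕ), s.BitsLE (q.eval z) → s 0 1 ≤ z → s 0 2 ≤ z →
      ∃ c ≤ p.eval z, Exec P.toProg s c (P.run s) := by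
  induction P generalizing q with
  | skip => exact ⟨1, fun s z _ _ _ => ⟨1, by simp, Exec.skip s⟩⟩
  | set a e₁ e₂ =>
    obtain ⟨K, hK⟩ := e₁.exists_cost_le
    obtain ⟨L, hL⟩ := e₂.exists_cost_le
    refine ⟨Polynomial.C (2 * K + 2 * L) * (q + 1) + 1, fun s z hs _ _ =>
      ⟨_, ?_, Exec.set s a e₁ e₂⟩⟩
    simp only [Polynomial.eval_add, Polynomial.eval_mul, Polynomial.eval_C, Polynomial.eval_one]
    have h1 := hK s _ hs
    have h2 := hL s _ hs
    linarith
  | seq P Q ihP ihQ =>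
    obtain ⟨g, hg⟩ := h.1.exists_growth
    obtain ⟨p₁, hp₁⟩ := ihP h.1 q
    -- The second program starts in a memory already grown by `g`; this is why `q` is generalized in
    -- the induction.
    obtain ⟨p₂, hp₂⟩ := ihQ h.2 (q + g)
    refine ⟨p₁ + p₂, fun s z hs h1 h2 => ?_⟩
    have e0 := run_of_notMem_writes P s h.1.zero_notMem_writes
    obtain ⟨c, hc, hex⟩ := hp₁ s z hs h1 h2
    obtain ⟨d, hd, hex'⟩ := hp₂ (P.run s) z (by rw [Polynomial.eval_add]; exact hg s _ z hs h1 h2)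
      (by rwa [e0]) (by rwa [e0])
    exact ⟨c + d, by rw [Polynomial.eval_add]; omega, Exec.seq hex hex'⟩
  | cond e P Q ihP ihQ =>
    obtain ⟨K, hK⟩ := e.exists_cost_le
    obtain ⟨p₁, hp₁⟩ := ihP h.1 q
    obtain ⟨p₂, hp₂⟩ := ihQ h.2 q
    refine ⟨Polynomial.C (2 * K) * (q + 1) + 1 + p₁ + p₂, fun s z hs h1 h2 => ?_⟩
    have hk := hK s _ hs
    simp only [Polynomial.eval_add, Polynomial.eval_mul, Polynomial.eval_C, Polynomial.eval_one,
      run]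
    split_ifs with he
    · obtain ⟨c, hc, hex⟩ := hp₁ s z hs h1 h2
      exact ⟨_, by linarith, Exec.cond_true he hex⟩
    · obtain ⟨c, hc, hex⟩ := hp₂ s z hs h1 h2
      exact ⟨_, by linarith, Exec.cond_false (not_not.1 he) hex⟩
  | rep a b P ih =>
    obtain ⟨ha, hb, haP, hP⟩ := h
    obtain ⟨g, hg⟩ := hP.exists_growth
    obtain ⟨p, hp⟩ := ih hP (q + Polynomial.X * (g + 2))
    obtain ⟨K, hK⟩ := (Expr.bin .sub (.get 0 (.const b)) (.get a (.const 0))).exists_cost_le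
    obtain ⟨L, hL⟩ := (Expr.bin .add (.get a (.const 0)) (.const 1)).exists_cost_le
    let E : Polynomial ℕ := Polynomial.C (2 * K + 2 * L) * (q + Polynomial.X * (g + 2) + 1)
    refine ⟨Polynomial.X * (p + 2 * E + 4) + E + 4, fun s z hs h1 h2 => ?_⟩
    have hbz : s 0 b ≤ z := by rcases hb with rfl | rfl <;> assumption
    have ew : s.write a 0 0 0 = s 0 := Mem.write_of_ne _ _ _ ha.symm
    have hEz : E.eval z = (2 * K + 2 * L) * ((q + Polynomial.X * (g + 2)).eval z + 1) := by
      simp [E]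
    obtain ⟨c, hc, hex⟩ := exec_loop (B₁ := (q + Polynomial.X * (g + 2)).eval z) (z := z)
      (g := g.eval z) (D := p.eval z) (E := E.eval z) ha haP hP.zero_notMem_writes
      (fun s B => hg s B z) (fun s => hp s z)
      (fun s hs => by
        have a1 := hK s _ hs
        have a2 := hL s _ hs
        rw [hEz]
        constructor <;> nlinarith)
      (s 0 b) (s.write a 0 0) (q.eval z) (hs.write (by simp) _ _)
      (by simp only [Polynomial.eval_add, Polynomial.eval_mul, Polynomial.eval_X,
            Polynomial.eval_ofNat]
          gcongr)
      (by rwa [ew]) (by rwa [ew]) (by simp [ew, Mem.write_same])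
    refine ⟨_, ?_, Exec.seq (Exec.set s a (.const 0) (.const 0)) hex⟩
    have hm : s 0 b * (p.eval z + 2 * E.eval z + 4) ≤ z * (p.eval z + 2 * E.eval z + 4) := by
      gcongr
    simp only [Polynomial.eval_add, Polynomial.eval_mul, Polynomial.eval_X, Polynomial.eval_ofNat,
      Expr.cost, Expr.eval, Nat.size_zero]
    omega

end Cmd

theorem length_le_inputSize (l : List ℕ) : l.length ≤ inputSize l := by
  unfold inputSize
  induction l with
  | nil => simp
  | cons x l ih => simp only [List.length_cons, List.map_cons, List.sum_cons]; omega

theorem size_le_inputSize {l : List ℕ} {x : ℕ} (h : x ∈ l) : Nat.size x ≤ inputSize l := by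
  have := List.single_le_sum (l := l.map fun x => Nat.size x + 1) (by simp) _
    (List.mem_map_of_mem h)
  unfold inputSize
  omega

theorem size_self_le (n : ℕ) : Nat.size n ≤ n := by
  rw [Nat.size_le]; exact Nat.lt_two_pow_self

theorem load_bitsLE (l : List ℕ) : (load l).BitsLE (inputSize l) := by
  intro a i
  unfold load
  split_ifs
  · cases i with
    -- Cell `0` holds the length, which the separators alone already pay for.
    | zero => exact (size_self_le _).trans (length_le_inputSize l)
    | succ i =>
      rw [List.getD_cons_succ, List.getD_eq_getElem?_getD]
      by_cases h : i < l.length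
      · simpa [h] using size_le_inputSize (l.getElem_mem h)
      · simp [h]
  · simp

/-- A tame program runs in polynomial time on all inputs whose first two entries are at most
the size of the input. -/
theorem Cmd.Tame.exists_exec_load {P : Cmd} (h : P.Tame) : ∃ p : Polynomial ℕ, ∀ l : List ℕ,
    load l 0 1 ≤ inputSize l → load l 0 2 ≤ inputSize l →
      ∃ c ≤ p.eval (inputSize l), Exec P.toProg (load l) c (P.run (load l)) := by
  obtain ⟨p, hp⟩ := h.exists_cost Polynomial.X
  exact ⟨p, fun l => hp _ _ (by simpa using load_bitsLE l)⟩

end RAM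

/-! ### Dominating matchings and rejections -/

namespace MEFE
namespace Inst

variable {I : Inst}

/-- Every TA weakly prefers `μ` to every fair matching, and `μ` uses acceptable pairs only. -/
structure Dominates (μ : I.Matching) : Prop where
  util_le : ∀ ν, I.Fair ν → ∀ t, I.util t (ν t) ≤ I.util t (μ t)
  acceptable : ∀ t x, μ t = some x → I.u t x ≠ 0

/-- `b` is a best course for `t` among those of utility smaller than `l`
(among all courses if `l = 0`). -/
structure IsBest (t : Fin I.m) (l : ℕ) (b : Option (Fin I.n)) : Prop where
  acceptable : ∀ x, b = some x → I.u t x ≠ 0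
  lt : ∀ x, b = some x → l = 0 ∨ I.u t x < l
  le : ∀ x, l = 0 ∨ I.u t x < l → I.u t x ≤ I.util t b

/-- The course `x` is not content with the TAs assigned to it. -/
def Overfull (μ : I.Matching) (x : Fin I.n) : Prop :=
  I.c x ≤ (I.assigned μ x).card ∧ (I.c x < (I.assigned μ x).card ∨
    (∑ t ∈ I.assigned μ x, I.v x t) * I.k.den < I.k.num * I.c x)

/-- Evidence that the TA `t` does not get the course `x` in any fair matching. -/
def Rejects (μ : I.Matching) (t : Fin I.m) (x : Fin I.n) : Prop :=
  (∃ t', I.g t x ≤ I.g t' x ∧ I.util t' (μ t') < I.u t' x) ∨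
    (I.Overfull μ x ∧ ∀ t', μ t' = some x → ¬ I.g t' x < I.g t x)

/-- The TA `t` has to leave its course. -/
def Leaves (μ : I.Matching) (t : Fin I.m) : Prop := ∃ x, μ t = some x ∧ I.Rejects μ t x

/-- The number of courses that the TA may still get. -/
def options (t : Fin I.m) (b : Option (Fin I.n)) : ℕ :=
  (Finset.univ.filter fun x => 0 < I.u t x ∧ I.u t x ≤ I.util t b).card

def potential (μ : I.Matching) : ℕ := ∑ t, options t (μ t)

theorem potential_le (μ : I.Matching) : potential μ ≤ I.n * I.m := by
  calc potential μ ≤ ∑ _t : Fin I.m, I.n := Finset.sum_le_sum fun t _ =>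
        (Finset.card_le_univ _).trans (by simp)
    _ = I.n * I.m := by simp [mul_comm]

/-- Clearing denominators gives a comparison of natural numbers that the machine can test;
`Overfull` contains its negation. -/
theorem le_avgUtil_iff (μ : I.Matching) (x : Fin I.n) :
    (I.k : ℚ) ≤ I.avgUtil μ x ↔
      I.k.num * I.c x ≤ (∑ t ∈ I.assigned μ x, I.v x t) * I.k.den := by
  unfold avgUtil
  generalize (∑ t ∈ I.assigned μ x, I.v x t) = S
  have hc : (0 : ℚ) < I.c x := by exact_mod_cast I.c_pos x
  have hd : (0 : ℚ) < I.k.den := by exact_mod_cast I.k.den_pos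
  have hk : (I.k : ℚ) = (I.k.num : ℚ) / I.k.den := by
    conv_lhs => rw [← NNRat.num_div_den I.k]
    push_cast; rfl
  rw [hk, div_le_div_iff₀ hd hc]
  exact_mod_cast Iff.rfl

/-- Domination gives `≤`. Equality would need a second acceptable course of the same utility, or
utility `0` for `x`. -/
theorem Restricted.util_lt (h : I.Restricted) {μ ν : I.Matching} (hμ : Dominates μ)
    (hν : I.Fair ν) {t : Fin I.m} {x : Fin I.n} (hx : μ t = some x) (hne : ν t ≠ some x) :
    I.util t (ν t) < I.u t x := by
  have h1 := hμ.util_le ν hν t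
  have h2 := hμ.acceptable t x hx
  rw [hx] at h1
  change _ ≤ I.u t x at h1
  refine lt_of_le_of_ne h1 ?_
  cases hy : ν t with
  | none => simpa [util] using h2.symm
  | some y =>
    have h3 := hν.feasible.2 t y hy
    exact h.strict t y x (by rintro rfl; exact hne hy) (Nat.pos_of_ne_zero h3)
      (Nat.pos_of_ne_zero h2)

/-- The key fact: no fair matching assigns the course to a rejected TA. -/
theorem Restricted.ne_of_rejects (h : I.Restricted) {μ ν : I.Matching} (hμ : Dominates μ)
    (hν : I.Fair ν) {t : Fin I.m} {x : Fin I.n} (hr : I.Rejects μ t x) :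
    ν t ≠ some x := by
  intro hνx
  rcases hr with ⟨t', hg, hu⟩ | ⟨⟨hc, hbad⟩, hlow⟩
  · refine hν.envy_free t' t ⟨x, hνx, hg, ?_⟩
    rw [hνx]
    exact (hμ.util_le ν hν t').trans_lt hu
  -- If `ν` kept every TA of `x`, the cardinalities would make the two sets equal, and `ν` would
  -- violate the capacity or the threshold at `x`.
  · obtain ⟨t', ht', hne⟩ : ∃ t' ∈ I.assigned μ x, t' ∉ I.assigned ν x := by
      by_contra! hsub
      have heq : I.assigned μ x = I.assigned ν x :=
        Finset.eq_of_subset_of_card_le hsub (by rw [hν.feasible.1 x]; exact hc)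
      rw [heq, hν.feasible.1 x] at hbad
      have := (le_avgUtil_iff ν x).1 (hν.satisfied x)
      omega
    simp only [assigned, Finset.mem_filter, Finset.mem_univ, true_and] at ht' hne
    refine hν.envy_free t' t ⟨x, hνx, not_lt.1 (hlow t' ht'), ?_⟩
    rw [hνx]
    exact h.util_lt hμ hν ht' hne

theorem dominates_of_isBest {μ : I.Matching} (h : ∀ t, IsBest t 0 (μ t)) : Dominates μ where
  acceptable t x := (h t).acceptable x
  util_le ν _ t := by
    cases hy : ν t with
    | none => exact Nat.zero_le _
    | some y => exact (h t).le y (.inl rfl)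

/-- Since no fair matching gives `x` to `t`, the utility of `t` there is strictly below `I.u t x`,
and `b` is best in that range. -/
theorem Restricted.dominates_update (h : I.Restricted) {μ : I.Matching} (hμ : Dominates μ)
    {t : Fin I.m} {x : Fin I.n} (hx : μ t = some x) (hr : I.Rejects μ t x)
    {b : Option (Fin I.n)} (hb : IsBest t (I.u t x) b) : Dominates (Function.update μ t b) where
  acceptable t' y := by
    by_cases ht : t' = t
    · subst ht; simpa using hb.acceptable y
    · simpa [ht] using hμ.acceptable t' y
  util_le ν hν t' := by
    by_cases ht : t' = t
    · subst ht
      rw [Function.update_self]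
      have h1 := h.util_lt hμ hν hx (h.ne_of_rejects hμ hν hr)
      cases hy : ν t' with
      | none => exact Nat.zero_le _
      | some y =>
        rw [hy] at h1
        exact hb.le y (.inr h1)
    · rw [Function.update_of_ne ht]
      exact hμ.util_le ν hν t'

/-- The course `x` just left is no longer an option for `t`, and no option is gained. -/
theorem potential_update_lt {μ : I.Matching} (hμ : Dominates μ)
    {t : Fin I.m} {x : Fin I.n} (hx : μ t = some x)
    {b : Option (Fin I.n)} (hb : IsBest t (I.u t x) b) :
    potential (Function.update μ t b) < potential μ := by
  have hx0 := hμ.acceptable t x hx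
  have hlt : I.util t b < I.u t x := by
    cases b with
    | none => exact Nat.pos_of_ne_zero hx0
    | some y => exact (hb.lt y rfl).resolve_left hx0
  have ht : options t b < options t (μ t) := by
    refine Finset.card_lt_card (Finset.ssubset_iff_of_subset ?_ |>.2 ⟨x, ?_, ?_⟩)
    · intro y
      simp only [Finset.mem_filter, Finset.mem_univ, true_and, hx]
      rintro ⟨h1, h2⟩
      exact ⟨h1, h2.trans hlt.le⟩
    · simp only [Finset.mem_filter, Finset.mem_univ, true_and, hx]
      exact ⟨Nat.pos_of_ne_zero hx0, le_rfl⟩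
    · simp only [Finset.mem_filter, Finset.mem_univ, true_and, not_and, not_le]
      exact fun _ => hlt
  refine Finset.sum_lt_sum (fun t' _ => ?_) ⟨t, Finset.mem_univ _, by simpa using ht⟩
  by_cases h : t' = t
  · subst h; simpa using ht.le
  · simp [h]

theorem not_leaves_of_potential {μ : I.Matching} (hμ : Dominates μ) (h : potential μ = 0)
    (t : Fin I.m) : ¬ I.Leaves μ t := by
  rintro ⟨x, hx, -⟩
  have h1 := Finset.sum_eq_zero_iff.1 h t (Finset.mem_univ _)
  have h2 := Finset.filter_eq_empty_iff.1 (Finset.card_eq_zero.1 h1) (Finset.mem_univ x)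
  exact h2 ⟨Nat.pos_of_ne_zero (hμ.acceptable t x hx), by rw [hx]; exact le_rfl⟩

/-- The number of TAs with a course. -/
def matched (μ : I.Matching) : ℕ := (Finset.univ.filter fun t => μ t ≠ none).card

theorem matched_eq_sum (μ : I.Matching) : matched μ = ∑ x, (I.assigned μ x).card := by
  have : (Finset.univ.filter fun t => μ t ≠ none) =
      Finset.univ.biUnion fun x => I.assigned μ x := by
    ext t
    simp [assigned, Option.ne_none_iff_exists']
  rw [matched, this, Finset.card_biUnion]
  intro x _ y _ hxy
  rw [Function.onFun, Finset.disjoint_left]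
  simp only [assigned, Finset.mem_filter, Finset.mem_univ, true_and]
  intro t h1 h2
  exact hxy (Option.some.inj (h1.symm.trans h2))

/-- A TA with a course in `ν` has positive utility there, hence also in `μ`, where it must then have
a course too. -/
theorem Fair.sum_c_le_matched {μ ν : I.Matching} (hν : I.Fair ν) (hμ : Dominates μ) :
    ∑ x, I.c x ≤ matched μ := by
  calc ∑ x, I.c x = matched ν := by
        rw [matched_eq_sum]; exact Finset.sum_congr rfl fun x _ => (hν.feasible.1 x).symm
    _ ≤ matched μ := by
        refine Finset.card_le_card fun t => ?_
        simp only [Finset.mem_filter, Finset.mem_univ, true_and]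
        intro ht h0
        obtain ⟨y, hy⟩ := Option.ne_none_iff_exists'.1 ht
        have h1 := hμ.util_le ν hν t
        rw [h0, hy] at h1
        exact hν.feasible.2 t y hy (Nat.le_zero.1 h1)

/-- The TA of lowest grade at an overfull course would have to leave. -/
theorem not_overfull {μ : I.Matching} (h : ∀ t, ¬ I.Leaves μ t) (x : Fin I.n) :
    ¬ I.Overfull μ x := by
  intro hx
  have hne : (I.assigned μ x).Nonempty :=
    Finset.card_pos.1 ((I.c_pos x).trans_le hx.1)
  obtain ⟨t, ht, hmin⟩ := Finset.exists_min_image _ (fun t => I.g t x) hne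
  simp only [assigned, Finset.mem_filter, Finset.mem_univ, true_and] at ht hmin
  exact h t ⟨x, ht, .inr ⟨hx, fun t' ht' => not_lt.2 (hmin t' ht')⟩⟩

/-- No course exceeds its capacity, so the total count forces equality everywhere. A missed
threshold would then make a course overfull, and an envied TA would have to leave by the first kind
of evidence. -/
theorem Dominates.fair {μ : I.Matching} (hμ : Dominates μ) (h : ∀ t, ¬ I.Leaves μ t)
    (hc : ∑ x, I.c x ≤ matched μ) : I.Fair μ := by
  have hle : ∀ x ∈ Finset.univ, (I.assigned μ x).card ≤ I.c x := by
    intro x _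
    by_contra! hlt
    exact not_overfull h x ⟨hlt.le, .inl hlt⟩
  have heq : ∀ x, (I.assigned μ x).card = I.c x := by
    rw [matched_eq_sum] at hc
    intro x
    exact (Finset.sum_eq_sum_iff_of_le hle).1 ((Finset.sum_le_sum hle).antisymm hc) x
      (Finset.mem_univ x)
  refine ⟨⟨heq, hμ.acceptable⟩, fun x => ?_, ?_⟩
  · rw [le_avgUtil_iff]
    by_contra! hlt
    exact not_overfull h x ⟨(heq x).ge, .inr hlt⟩
  · rintro t t' ⟨x, hx, hg, hu⟩
    rw [hx] at hu
    exact h t' ⟨x, hx, .inl ⟨t, hg, hu⟩⟩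

end Inst
end MEFE

/-! ### Layout of the encoded instance in memory -/

namespace MEFE
namespace Inst

theorem length_rows {a b : ℕ} (f : Fin a → Fin b → ℕ) : (rows f).length = a * b := by
  simp [rows, List.length_flatten, List.map_ofFn, Function.comp_def]

theorem rows_getElem? {a b : ℕ} (f : Fin a → Fin b → ℕ) (i : Fin a) (j : Fin b) :
    (rows f)[(i : ℕ) * b + j]? = some (f i j) := by
  have h : rows f = List.ofFn fun k : Fin (a * b) => f k.divNat k.modNat := by
    rw [List.ofFn_mul, rows]
    congr 2
    funext i
    congr 1
    funext j
    have hb : 0 < b := j.pos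
    congr 1
    · ext; simp [Fin.divNat, Nat.mul_add_div, mul_comm (i : ℕ) b, hb, Nat.div_eq_of_lt j.2]
    · ext; simp [Fin.modNat, Nat.mod_eq_of_lt j.2]
  have hlt : (i : ℕ) * b + j < a * b := by
    calc (i : ℕ) * b + j < (i + 1) * b := by rw [add_mul]; omega
      _ ≤ a * b := Nat.mul_le_mul_right _ i.2
  have hb : 0 < b := j.pos
  rw [h, List.getElem?_ofFn, dif_pos hlt]
  congr 2
  · ext; simp [Fin.divNat, Nat.mul_add_div, mul_comm (i : ℕ) b, hb, Nat.div_eq_of_lt j.2]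
  · ext; simp [Fin.modNat, Nat.mod_eq_of_lt j.2]

variable (I : Inst)

/-- The input array. -/
def input : ℕ → ℕ := RAM.load I.encode 0

theorem input_succ (i : ℕ) : I.input (i + 1) = (I.encode[i]?).getD 0 := by
  simp [input, RAM.load]

theorem input_n : I.input 1 = I.n := by rw [input_succ]; simp [encode]

theorem input_m : I.input 2 = I.m := by rw [input_succ]; simp [encode]

theorem input_num : I.input 3 = I.k.num := by rw [input_succ]; simp [encode]

theorem input_den : I.input 4 = I.k.den := by rw [input_succ]; simp [encode]

theorem getElem?_append_add {l₁ l₂ : List ℕ} {k i : ℕ} (h : l₁.length = k) :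
    (l₁ ++ l₂)[k + i]? = l₂[i]? := by
  rw [List.getElem?_append_right (by omega)]; congr 1; omega

theorem getElem?_append_some {l₁ l₂ : List ℕ} {i x : ℕ} (h : l₁[i]? = some x) :
    (l₁ ++ l₂)[i]? = some x := by
  obtain ⟨hi, -⟩ := List.getElem?_eq_some_iff.1 h
  rw [List.getElem?_append_left hi, h]

theorem input_c (x : Fin I.n) : I.input (5 + x) = I.c x := by
  rw [show 5 + (x : ℕ) = 4 + x + 1 by omega, input_succ, encode]
  simp only [List.append_assoc]
  rw [getElem?_append_add (by rfl), getElem?_append_some (x := I.c x) (by simp)]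
  rfl

theorem input_v (x : Fin I.n) (t : Fin I.m) :
    I.input (5 + I.n + (x * I.m + t)) = I.v x t := by
  rw [show 5 + I.n + ((x : ℕ) * I.m + t) = 4 + (I.n + (x * I.m + t)) + 1 by omega,
    input_succ, encode]
  simp only [List.append_assoc]
  rw [getElem?_append_add (by rfl), getElem?_append_add (by simp),
    getElem?_append_some (rows_getElem? _ _ _)]
  rfl

theorem input_u (t : Fin I.m) (x : Fin I.n) :
    I.input (5 + I.n + I.n * I.m + (t * I.n + x)) = I.u t x := by
  rw [show 5 + I.n + I.n * I.m + ((t : ℕ) * I.n + x) =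
    4 + (I.n + (I.n * I.m + (t * I.n + x))) + 1 by omega, input_succ, encode]
  simp only [List.append_assoc]
  rw [getElem?_append_add (by rfl), getElem?_append_add (by simp),
    getElem?_append_add (length_rows _), getElem?_append_some (rows_getElem? _ _ _)]
  rfl

theorem input_gnum (t : Fin I.m) (x : Fin I.n) :
    I.input (5 + I.n + I.n * I.m + I.n * I.m + (t * I.n + x)) = (I.g t x).num := by
  rw [show 5 + I.n + I.n * I.m + I.n * I.m + ((t : ℕ) * I.n + x) =
    4 + (I.n + (I.n * I.m + (I.n * I.m + (t * I.n + x)))) + 1 by omega, input_succ, encode]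
  simp only [List.append_assoc]
  rw [getElem?_append_add (by rfl), getElem?_append_add (by simp),
    getElem?_append_add (length_rows _), getElem?_append_add ((length_rows _).trans (mul_comm _ _)),
    getElem?_append_some (rows_getElem? _ _ _)]
  rfl

theorem input_gden (t : Fin I.m) (x : Fin I.n) :
    I.input (5 + I.n + I.n * I.m + I.n * I.m + I.n * I.m + (t * I.n + x)) = (I.g t x).den := by
  rw [show 5 + I.n + I.n * I.m + I.n * I.m + I.n * I.m + ((t : ℕ) * I.n + x) =
    4 + (I.n + (I.n * I.m + (I.n * I.m + (I.n * I.m + (t * I.n + x))))) + 1 by omega,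
    input_succ, encode]
  simp only [List.append_assoc]
  rw [getElem?_append_add (by rfl), getElem?_append_add (by simp),
    getElem?_append_add (length_rows _), getElem?_append_add ((length_rows _).trans (mul_comm _ _)),
    getElem?_append_add ((length_rows _).trans (mul_comm _ _)),
    getElem?_append_some (rows_getElem? _ _ _)]
  rfl

/-- The capacities contribute `n` entries, so this loop bound is at most the input size although it
is written in binary. -/
theorem input_n_le : I.input 1 ≤ RAM.inputSize I.encode := by
  rw [input_n]
  refine le_trans ?_ (RAM.length_le_inputSize _)
  simp only [encode, List.length_append, List.length_ofFn]; omega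

/-- The appended `List.range I.m` provides `m` entries even when there are no courses. -/
theorem input_m_le : I.input 2 ≤ RAM.inputSize I.encode := by
  rw [input_m]
  refine le_trans ?_ (RAM.length_le_inputSize _)
  simp only [encode, List.length_append, List.length_range]; omega

end Inst

/-! ### The program -/

namespace Alg

open RAM RAM.Expr

/-- The scalar variable held in cell `0` of array `a`. -/
def reg (a : ℕ) : Expr := .get a (.const 0)

def add (e f : Expr) : Expr := .bin .add e f

def sub (e f : Expr) : Expr := .bin .sub e f

def mul (e f : Expr) : Expr := .bin .mul e f

def assign (a : ℕ) (e : Expr) : Cmd := .set a (.const 0) e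

/-- The input cell at offset `o` after the capacities and `j` matrices. -/
def inputAt (j : ℕ) (o : Expr) : Expr :=
  -- Cells `0` to `4` hold the length, `n`, `m`, and the numerator and denominator of `k`.
  .get 0 (add (add (add (.const 5) (.get 0 (.const 1)))
    (mul (.const j) (mul (.get 0 (.const 1)) (.get 0 (.const 2))))) o)

def cap (x : Expr) : Expr := .get 0 (add (.const 5) x)

def courseUtil (x t : Expr) : Expr := inputAt 0 (add (mul x (.get 0 (.const 2))) t)

def taUtil (t x : Expr) : Expr := inputAt 1 (add (mul t (.get 0 (.const 1))) x)

def gradeNum (t x : Expr) : Expr := inputAt 2 (add (mul t (.get 0 (.const 1))) x)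

def gradeDen (t x : Expr) : Expr := inputAt 3 (add (mul t (.get 0 (.const 1))) x)

/-- The course of a TA, shifted by one; `0` if there is none. -/
def cur (t : Expr) : Expr := .get 1 (add t (.const 2))

/-- The utility of a TA for its own course. -/
def curUtil (t : Expr) : Expr :=
  -- The first factor is `1` if the TA has a course and `0` otherwise; it cancels the meaningless
  -- lookup in the latter case.
  mul (sub (.const 1) (sub (.const 1) (cur t))) (taUtil t (sub (cur t) (.const 1)))

/-- One step of `advance`. -/
def advanceStep : Cmd :=
  -- Nonzero if register `3` is `0` (no bound) or exceeds the utility. Register `5` starts at `0`,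
  -- so only courses of positive utility are taken.
  .cond (add (sub (.const 1) (reg 3)) (sub (reg 3) (taUtil (reg 2) (reg 6))))
    (.cond (sub (taUtil (reg 2) (reg 6)) (reg 5))
      (.seq (assign 4 (add (reg 6) (.const 1))) (assign 5 (taUtil (reg 2) (reg 6)))) .skip) .skip

/-- Gives the TA in register `2` its best course below the utility in register `3`. -/
def advance : Cmd :=
  .seq (assign 4 (.const 0)) (.seq (assign 5 (.const 0)) (.seq (.rep 6 1 advanceStep)
    (.set 1 (add (reg 2) (.const 2)) (reg 4))))

/-- Nonzero if the TA in register `7` does not have the course in register `8`. -/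
def elsewhere : Expr :=
  add (sub (cur (reg 7)) (add (reg 8) (.const 1))) (sub (add (reg 8) (.const 1)) (cur (reg 7)))

/-- Nonzero if the TA in register `7` has a lower grade than the TA in register `2`. -/
def lower : Expr :=
  sub (mul (gradeNum (reg 2) (reg 8)) (gradeDen (reg 7) (reg 8)))
    (mul (gradeNum (reg 7) (reg 8)) (gradeDen (reg 2) (reg 8)))

/-- Nonzero if the TA in register `7` prefers the course in register `8` to its own. -/
def prefers : Expr := sub (taUtil (reg 7) (reg 8)) (curUtil (reg 7))

/-- Counts the TA in register `7` if it has the course in register `8`. -/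
def tally : Cmd :=
  .cond elsewhere .skip
    (.seq (assign 9 (add (reg 9) (.const 1)))
      (assign 10 (add (reg 10) (courseUtil (reg 8) (reg 7)))))

/-- Compares the TA in register `7` with the TA in register `2`. -/
def compareTAs : Cmd :=
  .cond lower (.cond elsewhere .skip (assign 11 (.const 0)))
    (.cond prefers (assign 12 (.const 1)) .skip)

def inspectStep : Cmd := .seq tally compareTAs

/-- Sets register `12` if the TA in register `2` has to leave its course in register `8`. -/
def inspect : Cmd :=
  -- Register `9` counts the TAs of the course, `10` sums their values, `11` stays `1` while none of
  -- them has a lower grade, and `12` is the verdict.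
  .seq (assign 9 (.const 0)) (.seq (assign 10 (.const 0)) (.seq (assign 11 (.const 1))
    (.seq (assign 12 (.const 0)) (.seq (.rep 7 2 inspectStep)
      (.cond (reg 11)
        -- The added `1` makes truncated subtraction test `≤` instead of `<`.
        (.cond (sub (add (reg 9) (.const 1)) (cap (reg 8)))
          (.cond (add (sub (reg 9) (cap (reg 8)))
              (sub (mul (.get 0 (.const 3)) (cap (reg 8))) (mul (reg 10) (.get 0 (.const 4)))))
            (assign 12 (.const 1)) .skip) .skip) .skip)))))

/-- Moves the TA in register `2` on if it has to leave its course. -/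
def update : Cmd :=
  .cond (cur (reg 2))
    (.seq (assign 8 (sub (cur (reg 2)) (.const 1))) (.seq inspect
      (.cond (reg 12) (.seq (assign 3 (taUtil (reg 2) (reg 8))) advance) .skip))) .skip

/-- Writes the answer. -/
def answer : Cmd :=
  -- Subtracting `1` per employed TA from the total capacity leaves `0` exactly if enough TAs are
  -- employed. The matching already occupies its output cells, so only the length and the flag are
  -- written.
  .seq (assign 9 (.const 0)) (.seq (.rep 6 1 (assign 9 (add (reg 9) (cap (reg 6)))))
    (.seq (.rep 2 2 (.cond (cur (reg 2)) (assign 9 (sub (reg 9) (.const 1))) .skip))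
      (.cond (reg 9)
        (.seq (assign 1 (.const 1)) (.set 1 (.const 1) (.const 0)))
        (.seq (assign 1 (add (.get 0 (.const 2)) (.const 1))) (.set 1 (.const 1) (.const 1))))))

/-- Gives every TA its best course. -/
def init : Cmd := .rep 2 2 (.seq (assign 3 (.const 0)) advance)

/-- As many rounds of updates as the initial potential can require. -/
def improve : Cmd := .rep 13 1 (.rep 14 2 (.rep 2 2 update))

/-- Starting from the best course of every TA, moves TAs on as long as one of them holds a course
that it gets in no fair matching; the result is fair unless there is no fair matching. -/
def main : Cmd := .seq init (.seq improve answer)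

theorem main_tame : main.Tame := by
  simp [main, init, improve, answer, update, inspect, inspectStep, tally, compareTAs, advance,
    advanceStep, Cmd.Tame,
    assign, reg, add, sub, cap, taUtil, courseUtil, inputAt, cur, Cmd.writes, Expr.Additive]

end Alg
end MEFE

/-! ### Evaluation of expressions and the search for a best course -/

namespace MEFE
namespace Alg

open RAM RAM.Expr

variable {I : Inst}

theorem write_apply (s : Mem) (a i x b : ℕ) :
    s.write a i x b = if b = a then Function.update (s b) i x else s b := by
  by_cases h : b = a
  · subst h; simp [Mem.write_same]
  · simp [Mem.write_of_ne, h]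

def code : Option (Fin I.n) → ℕ
  | none => 0
  | some x => x + 1

theorem code_eq_iff {b : Option (Fin I.n)} {x : Fin I.n} : code b = x + 1 ↔ b = some x := by
  cases b with
  | none => simp [code]
  | some y => simp [code, Fin.ext_iff]

theorem code_eq_zero_iff {b : Option (Fin I.n)} : code b = 0 ↔ b = none := by
  cases b <;> simp [code]

/-- The memory contains the input and the matching `μ`. -/
structure Holds (μ : I.Matching) (s : Mem) : Prop where
  input : s 0 = I.input
  course : ∀ t : Fin I.m, s 1 (t + 2) = code (μ t)

def taUtilAt (i : ℕ → ℕ) (t x : ℕ) : ℕ := i (5 + i 1 + i 1 * i 2 + (t * i 1 + x))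

def courseUtilAt (i : ℕ → ℕ) (x t : ℕ) : ℕ := i (5 + i 1 + (x * i 2 + t))

def gradeNumAt (i : ℕ → ℕ) (t x : ℕ) : ℕ := i (5 + i 1 + i 1 * i 2 + i 1 * i 2 + (t * i 1 + x))

def gradeDenAt (i : ℕ → ℕ) (t x : ℕ) : ℕ :=
  i (5 + i 1 + i 1 * i 2 + i 1 * i 2 + i 1 * i 2 + (t * i 1 + x))

theorem taUtilAt_input (t : Fin I.m) (x : Fin I.n) : taUtilAt I.input t x = I.u t x := by
  simp only [taUtilAt, Inst.input_n, Inst.input_m, Inst.input_u]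

theorem courseUtilAt_input (x : Fin I.n) (t : Fin I.m) :
    courseUtilAt I.input x t = I.v x t := by
  simp only [courseUtilAt, Inst.input_n, Inst.input_m, Inst.input_v]

theorem gradeNumAt_input (t : Fin I.m) (x : Fin I.n) :
    gradeNumAt I.input t x = (I.g t x).num := by
  simp only [gradeNumAt, Inst.input_n, Inst.input_m, Inst.input_gnum]

theorem gradeDenAt_input (t : Fin I.m) (x : Fin I.n) :
    gradeDenAt I.input t x = (I.g t x).den := by
  simp only [gradeDenAt, Inst.input_n, Inst.input_m, Inst.input_gden]

theorem eval_reg (s : Mem) (a : ℕ) : (reg a).eval s = s a 0 := rfl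

theorem eval_add (s : Mem) (e f : Expr) : (add e f).eval s = e.eval s + f.eval s := rfl

theorem eval_sub (s : Mem) (e f : Expr) : (sub e f).eval s = e.eval s - f.eval s := rfl

theorem eval_mul (s : Mem) (e f : Expr) : (mul e f).eval s = e.eval s * f.eval s := rfl

theorem eval_const (s : Mem) (n : ℕ) : (Expr.const n).eval s = n := rfl

theorem eval_get (s : Mem) (a n : ℕ) : (Expr.get a (.const n)).eval s = s a n := rfl

theorem eval_cap (s : Mem) (x : Expr) : (cap x).eval s = s 0 (5 + x.eval s) := rfl

theorem eval_cur (s : Mem) (t : Expr) : (cur t).eval s = s 1 (t.eval s + 2) := rfl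

theorem eval_taUtil (s : Mem) (t x : Expr) :
    (taUtil t x).eval s = taUtilAt (s 0) (t.eval s) (x.eval s) := by
  simp [taUtil, inputAt, add, mul, Expr.eval, Op.eval, taUtilAt]

theorem eval_courseUtil (s : Mem) (x t : Expr) :
    (courseUtil x t).eval s = courseUtilAt (s 0) (x.eval s) (t.eval s) := by
  simp [courseUtil, inputAt, add, mul, Expr.eval, Op.eval, courseUtilAt]

theorem eval_gradeNum (s : Mem) (t x : Expr) :
    (gradeNum t x).eval s = gradeNumAt (s 0) (t.eval s) (x.eval s) := by
  simp only [gradeNum, inputAt, add, mul, Expr.eval, Op.eval, gradeNumAt]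
  congr 2; ring

theorem eval_gradeDen (s : Mem) (t x : Expr) :
    (gradeDen t x).eval s = gradeDenAt (s 0) (t.eval s) (x.eval s) := by
  simp only [gradeDen, inputAt, add, mul, Expr.eval, Op.eval, gradeDenAt]
  congr 2; ring

theorem eval_curUtil (s : Mem) (t : Expr) : (curUtil t).eval s =
    (1 - (1 - s 1 (t.eval s + 2))) * taUtilAt (s 0) (t.eval s) (s 1 (t.eval s + 2) - 1) := by
  simp only [curUtil, eval_mul, eval_sub, eval_const, eval_cur, eval_taUtil]

theorem taUtilAt_code (t : Fin I.m) (b : Option (Fin I.n)) :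
    (1 - (1 - code b)) * taUtilAt I.input t (code b - 1) = I.util t b := by
  cases b with
  | none => simp [code, Inst.util]
  | some x => simp [code, Inst.util, taUtilAt_input]

theorem run_advance {s : Mem} {t : Fin I.m} {l : ℕ} (h0 : s 0 = I.input) (h2 : s 2 0 = t)
    (h3 : s 3 0 = l) : ∃ b : Option (Fin I.n), Inst.IsBest t l b ∧
      advance.run s 1 = Function.update (s 1) (t + 2) (code b) := by
  have key := Cmd.run_rep (a := 6) (b := 1) (P := advanceStep)
    (s := (assign 5 (.const 0)).run ((assign 4 (.const 0)).run s))
    -- Registers `4` and `5` describe a best admissible choice `b` among the first `j` courses.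
    (fun j r => r 0 = I.input ∧ r 1 = s 1 ∧ r 2 0 = t ∧ r 3 0 = l ∧
      ∃ b : Option (Fin I.n), r 4 0 = code b ∧ r 5 0 = I.util t b ∧
        (∀ x, b = some x → I.u t x ≠ 0) ∧ (∀ x, b = some x → l = 0 ∨ I.u t x < l) ∧
        ∀ x : Fin I.n, (x : ℕ) < j → l = 0 ∨ I.u t x < l → I.u t x ≤ I.util t b)
    (by decide)
    ⟨by simpa [assign, Cmd.run, write_apply] using h0, by simp [assign, Cmd.run, write_apply],
      by simpa [assign, Cmd.run, write_apply] using h2,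
      by simpa [assign, Cmd.run, write_apply] using h3, none,
      by simp [assign, Cmd.run, write_apply, Expr.eval, code],
      by simp [assign, Cmd.run, write_apply, Expr.eval, Inst.util], by simp, by simp, by simp⟩
    (by
      rintro j r hj hr ⟨r0, r1, r2, r3, b, r4, r5, hacc, hlt, hle⟩
      have hin : (assign 5 (.const 0)).run ((assign 4 (.const 0)).run s) 0 = I.input := by
        simpa [assign, Cmd.run, write_apply] using h0
      rw [hin, Inst.input_n] at hj
      obtain ⟨x, rfl⟩ : ∃ x : Fin I.n, (x : ℕ) = j := ⟨⟨j, hj⟩, rfl⟩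
      simp only [advanceStep, assign, Cmd.run, eval_add, eval_sub, eval_const, eval_reg,
        eval_taUtil, r0, r2, r3, r5, hr, taUtilAt_input]
      have hcases : ∀ y : Fin I.n, (y : ℕ) < x + 1 → (y : ℕ) < x ∨ y = x := fun y hy => by
        rw [Fin.ext_iff]; omega
      split_ifs with c1 c2
      · refine ⟨by simp [write_apply, r0], by simp [write_apply, r1], by simp [write_apply, r2],
          by simp [write_apply, r3], some x, by simp [write_apply, code],
          by simp [write_apply, Inst.util, r0, r2, hr, taUtilAt_input], ?_, ?_, ?_⟩
        · rintro y hy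
          obtain rfl := Option.some.inj hy
          omega
        · rintro y hy
          obtain rfl := Option.some.inj hy
          omega
        · intro y hy hyl
          change _ ≤ I.u t x
          rcases hcases y hy with hy | rfl
          · have := hle y hy hyl
            omega
          · exact le_rfl
      · refine ⟨by simp [write_apply, r0], by simp [write_apply, r1], by simp [write_apply, r2],
          by simp [write_apply, r3], b, by simp [write_apply, r4], by simp [write_apply, r5],
          hacc, hlt, ?_⟩
        intro y hy hyl
        rcases hcases y hy with hy | rfl
        · exact hle y hy hyl
        · omega
      · refine ⟨by simp [write_apply, r0], by simp [write_apply, r1], by simp [write_apply, r2],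
          by simp [write_apply, r3], b, by simp [write_apply, r4], by simp [write_apply, r5],
          hacc, hlt, ?_⟩
        intro y hy hyl
        rcases hcases y hy with hy | rfl
        · exact hle y hy hyl
        · omega)
  obtain ⟨k0, k1, k2, k3, b, k4, k5, hacc, hlt, hle⟩ := key
  refine ⟨b, ⟨hacc, hlt, fun x => hle x ?_⟩, ?_⟩
  · simp [assign, Cmd.run, write_apply, h0, Inst.input_n]
  · rw [← k1, ← k2, ← k4]
    simp [advance, Cmd.run, write_apply, eval_add, eval_reg, eval_const]

theorem Holds.exists_advance {μ : I.Matching} {s : Mem} (h : Holds μ s) {t : Fin I.m}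
    (h2 : s 2 0 = t) :
    ∃ b, Inst.IsBest t (s 3 0) b ∧ Holds (Function.update μ t b) (advance.run s) := by
  obtain ⟨b, hb, hrun⟩ := run_advance h.input h2 rfl
  refine ⟨b, hb, by rw [Cmd.run_of_notMem_writes _ _ (by decide), h.input], fun t' => ?_⟩
  rw [hrun]
  by_cases ht : t' = t
  · subst ht; simp
  · rw [Function.update_of_ne, Function.update_of_ne ht, h.course]
    simpa [Fin.ext_iff] using ht

/-- Loop invariants express tallies as sums over all indices cut off at the counter; this is their
increment. -/
theorem sum_ite_lt_succ {m : ℕ} (f : Fin m → ℕ) (j : Fin m) :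
    (∑ t : Fin m, if (t : ℕ) < j + 1 then f t else 0) =
      (∑ t : Fin m, if (t : ℕ) < j then f t else 0) + f j := by
  have h : ∀ t : Fin m, (if (t : ℕ) < j + 1 then f t else 0) =
      (if (t : ℕ) < j then f t else 0) + if t = j then f j else 0 := by
    intro t
    rcases lt_trichotomy (t : ℕ) j with h | h | h
    · simp [h, h.le, Fin.ext_iff, h.ne]
    · obtain rfl := Fin.ext h
      simp
    · rw [if_neg (by omega), if_neg (by omega), if_neg (by rw [Fin.ext_iff]; omega)]
  rw [Finset.sum_congr rfl fun t _ => h t, Finset.sum_add_distrib]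
  simp

end Alg
end MEFE

/-! ### Correctness of the rejection test -/

namespace MEFE
namespace Alg

open RAM RAM.Expr

variable {I : Inst}

theorem sum_assigned (μ : I.Matching) (x : Fin I.n) (f : Fin I.m → ℕ) :
    ∑ t ∈ I.assigned μ x, f t = ∑ t, if μ t = some x then f t else 0 := by
  rw [Inst.assigned, Finset.sum_filter]

/-- The two truncated differences add up to the distance of the codes. -/
theorem eval_elsewhere {μ : I.Matching} {r : Mem} {t : Fin I.m} {x : Fin I.n}
    (h : Holds μ r) (h7 : r 7 0 = t) (h8 : r 8 0 = x) :
    elsewhere.eval r ≠ 0 ↔ μ t ≠ some x := by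
  simp only [elsewhere, eval_add, eval_sub, eval_const, eval_cur, eval_reg, h7, h8, h.course]
  rw [not_iff_not, ← code_eq_iff]
  omega

theorem eval_lower {r : Mem} {t t' : Fin I.m} {x : Fin I.n} (h : r 0 = I.input)
    (h2 : r 2 0 = t) (h7 : r 7 0 = t') (h8 : r 8 0 = x) :
    lower.eval r ≠ 0 ↔ I.g t' x < I.g t x := by
  simp only [lower, eval_sub, eval_mul, eval_reg, eval_gradeNum, eval_gradeDen, h, h2, h7, h8,
    gradeNumAt_input, gradeDenAt_input]
  rw [NNRat.lt_def, Nat.sub_ne_zero_iff_lt]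

theorem eval_prefers {μ : I.Matching} {r : Mem} {t : Fin I.m} {x : Fin I.n}
    (h : Holds μ r) (h7 : r 7 0 = t) (h8 : r 8 0 = x) :
    prefers.eval r ≠ 0 ↔ I.util t (μ t) < I.u t x := by
  simp only [prefers, eval_sub, eval_reg, eval_taUtil, eval_curUtil, h.input, h.course, h7, h8,
    taUtilAt_input, taUtilAt_code]
  exact Nat.sub_ne_zero_iff_lt

theorem run_tally {μ : I.Matching} {r : Mem} {t : Fin I.m} {x : Fin I.n}
    (h : Holds μ r) (h7 : r 7 0 = t) (h8 : r 8 0 = x) :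
    (tally.run r 9 0 = r 9 0 + if μ t = some x then 1 else 0) ∧
    (tally.run r 10 0 = r 10 0 + if μ t = some x then I.v x t else 0) := by
  simp only [tally, Cmd.run, eval_elsewhere h h7 h8]
  by_cases c : μ t = some x
  · simp [c, assign, Cmd.run, eval_add, eval_const, eval_reg, eval_courseUtil, write_apply,
      h.input, h7, h8, courseUtilAt_input]
  · simp [c]

/-- The grade test separates the roles of `t'`: with a lower grade it can only refute that `t` is
lowest at `x`, otherwise it can only be a potential envier. -/
theorem run_compareTAs {μ : I.Matching} {r : Mem} {t t' : Fin I.m} {x : Fin I.n}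
    (h : Holds μ r) (h2 : r 2 0 = t) (h7 : r 7 0 = t') (h8 : r 8 0 = x) :
    (compareTAs.run r 11 0 = if μ t' = some x ∧ I.g t' x < I.g t x then 0 else r 11 0) ∧
    (compareTAs.run r 12 0 =
      if I.g t x ≤ I.g t' x ∧ I.util t' (μ t') < I.u t' x then 1 else r 12 0) := by
  simp only [compareTAs, Cmd.run, eval_elsewhere h h7 h8, eval_lower h.input h2 h7 h8,
    eval_prefers h h7 h8]
  by_cases c2 : I.g t' x < I.g t x
  · by_cases c1 : μ t' = some x <;>
      simp [c1, c2, assign, Cmd.run, eval_const, write_apply]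
  · by_cases c3 : I.util t' (μ t') < I.u t' x <;>
      simp [c2, not_lt.1 c2, c3, assign, Cmd.run, eval_const, write_apply]

theorem Holds.congr {μ : I.Matching} {r s : Mem} (h : Holds μ r) (h0 : s 0 = r 0)
    (h1 : s 1 = r 1) : Holds μ s :=
  ⟨h0.trans h.input, fun t => by rw [h1, h.course]⟩

theorem Holds.run {μ : I.Matching} {s : Mem} (h : Holds μ s) (P : Cmd) (h0 : 0 ∉ P.writes)
    (h1 : 1 ∉ P.writes) : Holds μ (P.run s) :=
  h.congr (P.run_of_notMem_writes s h0) (P.run_of_notMem_writes s h1)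

theorem Holds.write {μ : I.Matching} {s : Mem} (h : Holds μ s) {a : ℕ} (ha : 2 ≤ a) (i x : ℕ) :
    Holds μ (s.write a i x) :=
  h.congr (Mem.write_of_ne _ _ _ (by omega)) (Mem.write_of_ne _ _ _ (by omega))

theorem exists_lt_succ_iff {m : ℕ} {p : Fin m → Prop} (j : Fin m) :
    (∃ t : Fin m, (t : ℕ) < j + 1 ∧ p t) ↔ (∃ t : Fin m, (t : ℕ) < j ∧ p t) ∨ p j := by
  constructor
  · rintro ⟨t, ht, hp⟩
    rcases (Nat.lt_succ_iff_lt_or_eq.1 ht) with h | h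
    · exact .inl ⟨t, h, hp⟩
    · exact .inr (Fin.ext h ▸ hp)
  · rintro (⟨t, ht, hp⟩ | hp)
    exacts [⟨t, by omega, hp⟩, ⟨j, by omega, hp⟩]

/-- After the loop, register `12` decides the first kind of evidence and register `11` whether `t`
is lowest; the final nested tests add the second kind. -/
theorem run_inspect {μ : I.Matching} {s : Mem} {t : Fin I.m} {x : Fin I.n}
    (h : Holds μ s) (h2 : s 2 0 = t) (h8 : s 8 0 = x) :
    inspect.run s 12 0 ≠ 0 ↔ I.Rejects μ t x := by
  let s₀ : Mem := (assign 12 (.const 0)).run ((assign 11 (.const 1)).run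
    ((assign 10 (.const 0)).run ((assign 9 (.const 0)).run s)))
  have hs₀ : Holds μ s₀ := (((h.run (assign 9 (.const 0)) (by decide) (by decide)).run _
    (by decide) (by decide)).run _ (by decide) (by decide)).run _ (by decide) (by decide)
  have key := Cmd.run_rep (a := 7) (b := 2) (P := inspectStep) (s := s₀)
    (fun j r => Holds μ r ∧ r 2 0 = t ∧ r 8 0 = x ∧
      r 9 0 = (∑ t' : Fin I.m, if (t' : ℕ) < j then if μ t' = some x then 1 else 0 else 0) ∧
      r 10 0 =
        (∑ t' : Fin I.m, if (t' : ℕ) < j then if μ t' = some x then I.v x t' else 0 else 0) ∧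
      (r 11 0 = 0 ↔ ∃ t' : Fin I.m, (t' : ℕ) < j ∧ μ t' = some x ∧ I.g t' x < I.g t x) ∧
      (r 12 0 ≠ 0 ↔ ∃ t' : Fin I.m, (t' : ℕ) < j ∧ I.g t x ≤ I.g t' x ∧
        I.util t' (μ t') < I.u t' x))
    (by decide)
    (by
      refine ⟨hs₀.write (by omega) _ _, ?_⟩
      simp [s₀, assign, Cmd.run, write_apply, eval_const, h2, h8])
    (by
      rintro j r hj hr ⟨r0, r2, r8, r9, r10, r11, r12⟩
      rw [hs₀.input, Inst.input_m] at hj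
      obtain ⟨t', rfl⟩ : ∃ t' : Fin I.m, (t' : ℕ) = j := ⟨⟨j, hj⟩, rfl⟩
      have hc : Holds μ (tally.run r) := r0.run _ (by decide) (by decide)
      have e2 := tally.run_of_notMem_writes r (d := 2) (by decide)
      have e7 := tally.run_of_notMem_writes r (d := 7) (by decide)
      have e8 := tally.run_of_notMem_writes r (d := 8) (by decide)
      have e11 := tally.run_of_notMem_writes r (d := 11) (by decide)
      have e12 := tally.run_of_notMem_writes r (d := 12) (by decide)
      obtain ⟨a9, a10⟩ := run_tally r0 hr r8
      obtain ⟨a11, a12⟩ := run_compareTAs hc (by rw [e2, r2]) (by rw [e7, hr]) (by rw [e8, r8])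
      have f2 := compareTAs.run_of_notMem_writes (tally.run r) (d := 2) (by decide)
      have f8 := compareTAs.run_of_notMem_writes (tally.run r) (d := 8) (by decide)
      have f9 := compareTAs.run_of_notMem_writes (tally.run r) (d := 9) (by decide)
      have f10 := compareTAs.run_of_notMem_writes (tally.run r) (d := 10) (by decide)
      refine ⟨(r0.run inspectStep (by decide) (by decide)).write (by omega) _ _, ?_⟩
      simp only [inspectStep, Cmd.run]
      simp only [write_apply, Nat.reduceEqDiff, if_false]
      rw [f2, e2, r2, f8, e8, r8, f9, a9, r9, f10, a10, r10, a11, a12, e11, e12,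
        sum_ite_lt_succ, sum_ite_lt_succ, exists_lt_succ_iff, exists_lt_succ_iff, ← r11, ← r12]
      refine ⟨rfl, rfl, rfl, rfl, ?_, ?_⟩
      · split_ifs with hq <;> simp [hq]
      · split_ifs with hq <;> simp [hq])
  obtain ⟨k0, k2, k8, k9, k10, k11, k12⟩ := key
  simp only [hs₀.input, Inst.input_m, Fin.is_lt, if_true, true_and] at k9 k10 k11 k12
  rw [← sum_assigned, Finset.sum_const, smul_eq_mul, mul_one] at k9
  rw [← sum_assigned] at k10
  change (Cmd.run (.cond (reg 11) _ _) ((Cmd.rep 7 2 inspectStep).run s₀)) 12 0 ≠ 0 ↔ _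
  generalize (Cmd.rep 7 2 inspectStep).run s₀ = w at *
  have hsub : ∀ a b : ℕ, a + 1 - b ≠ 0 ↔ b ≤ a := by omega
  have hsub' : ∀ a b c d : ℕ, a - b + (c - d) ≠ 0 ↔ b < a ∨ d < c := by omega
  simp only [Cmd.run, eval_reg, eval_add, eval_sub, eval_mul, eval_const, eval_get, eval_cap,
    k0.input, k8, k9, k10, Inst.input_c, Inst.input_num, Inst.input_den, hsub, hsub', assign]
  unfold Inst.Rejects Inst.Overfull
  rw [← k12]
  have hlow : w 11 0 ≠ 0 ↔
      ∀ t', μ t' = some x → ¬ I.g t' x < I.g t x := by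
    rw [Ne, k11]; push Not; rfl
  rw [← hlow]
  by_cases b1 : w 11 0 = 0
  · simp [b1]
  · by_cases b2 : I.c x ≤ (I.assigned μ x).card
    · by_cases b3 : I.c x < (I.assigned μ x).card ∨
          (∑ t ∈ I.assigned μ x, I.v x t) * I.k.den < I.k.num * I.c x
      · simp [write_apply, b1, b2, b3]
      · simp [b1, b3]
    · simp [b1, b2]

end Alg
end MEFE

/-! ### Initialization, sweeps, and the answer -/

namespace MEFE
namespace Alg

open RAM RAM.Expr

variable {I : Inst}

theorem exists_holds_init {s : Mem} (h0 : s 0 = I.input) :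
    ∃ μ : I.Matching, Inst.Dominates μ ∧ Holds μ (init.run s) := by
  have key := Cmd.run_rep (a := 2) (b := 2) (P := .seq (assign 3 (.const 0)) advance) (s := s)
    -- The values of `μ` from `j` on are arbitrary, so `Holds` is available only at the end.
    (fun j r => r 0 = I.input ∧ ∃ μ : I.Matching, ∀ t : Fin I.m, (t : ℕ) < j →
      Inst.IsBest t 0 (μ t) ∧ r 1 (t + 2) = code (μ t))
    (by decide) ⟨by simp [write_apply, h0], fun _ => none, by simp⟩
    (by
      rintro j r hj hr ⟨r0, μ, hμ⟩
      rw [h0, Inst.input_m] at hj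
      obtain ⟨t, rfl⟩ : ∃ t : Fin I.m, (t : ℕ) = j := ⟨⟨j, hj⟩, rfl⟩
      obtain ⟨b, hb, hrun⟩ := run_advance (s := (assign 3 (.const 0)).run r) (t := t) (l := 0)
        (by simp [assign, Cmd.run, write_apply, r0]) (by simp [assign, Cmd.run, write_apply, hr])
        (by simp [assign, Cmd.run, write_apply, Expr.eval])
      refine ⟨?_, Function.update μ t b, fun t' ht' => ?_⟩
      · rw [Mem.write_of_ne _ _ _ (by decide), Cmd.run_of_notMem_writes _ _ (by decide), r0]
      · rw [Mem.write_of_ne _ _ _ (by decide)]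
        simp only [Cmd.run]
        rw [hrun]
        by_cases h : t' = t
        · subst h; simpa using hb
        · have hne : (t' : ℕ) ≠ t := by simpa [Fin.ext_iff] using h
          rw [Function.update_of_ne h, Function.update_of_ne (by omega)]
          obtain ⟨h1, h2⟩ := hμ t' (by omega)
          exact ⟨h1, by simpa [assign, Cmd.run, write_apply] using h2⟩)
  obtain ⟨k0, μ, hμ⟩ := key
  rw [h0, Inst.input_m] at hμ
  exact ⟨μ, Inst.dominates_of_isBest fun t => (hμ t t.2).1, k0, fun t => (hμ t t.2).2⟩

/-- The step of the algorithm for one TA. -/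
theorem Holds.exists_update (hI : I.Restricted) {μ : I.Matching} {s : Mem} (h : Holds μ s)
    (hμ : Inst.Dominates μ) {t : Fin I.m} (h2 : s 2 0 = t) :
    (¬ I.Leaves μ t ∧ Holds μ (update.run s)) ∨
    (I.Leaves μ t ∧ ∃ ν : I.Matching, Inst.Dominates ν ∧
      Inst.potential ν < Inst.potential μ ∧ Holds ν (update.run s)) := by
  simp only [update, Cmd.run, eval_cur, eval_reg, h2, h.course]
  cases hx : μ t with
  | none =>
    left
    refine ⟨fun ⟨x, hx', _⟩ => ?_, by simpa [code] using h⟩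
    rw [hx] at hx'; cases hx'
  | some x =>
    rw [if_pos (by simp [code])]
    generalize hs₁ : (assign 8 (sub (cur (reg 2)) (.const 1))).run s = s₁
    have hH : Holds μ s₁ := hs₁ ▸ h.run _ (by decide) (by decide)
    have e2 : s₁ 2 0 = t := by simp [← hs₁, assign, Cmd.run, write_apply, h2]
    have e8 : s₁ 8 0 = x := by
      simp [← hs₁, assign, Cmd.run, write_apply, eval_sub, eval_cur, eval_reg, eval_const, h2,
        h.course, hx, code]
    have hrej := run_inspect hH e2 e8
    have hH' := hH.run inspect (by decide) (by decide)
    have e2' := inspect.run_of_notMem_writes s₁ (d := 2) (by decide)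
    have e8' := inspect.run_of_notMem_writes s₁ (d := 8) (by decide)
    by_cases hc : inspect.run s₁ 12 0 ≠ 0
    · simp only [ne_eq, hc, not_false_eq_true, if_true]
      right
      have hr := hrej.1 hc
      refine ⟨⟨x, hx, hr⟩, ?_⟩
      obtain ⟨b, hb, hν⟩ := (hH'.run (assign 3 (taUtil (reg 2) (reg 8))) (by decide)
        (by decide)).exists_advance (t := t) (by simp [assign, Cmd.run, write_apply, e2', e2])
      have e3 : (assign 3 (taUtil (reg 2) (reg 8))).run (inspect.run s₁) 3 0 = I.u t x := by
        simp [assign, Cmd.run, write_apply, eval_taUtil, eval_reg, eval_const, hH'.input, e2', e8', e2,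
          e8, taUtilAt_input]
      rw [e3] at hb
      exact ⟨_, hI.dominates_update hμ hx hr hb, Inst.potential_update_lt hμ hx hb, hν⟩
    · simp only [not_not.1 hc, ne_eq, not_true_eq_false, if_false]
      left
      refine ⟨fun ⟨y, hy, hr⟩ => ?_, hH'⟩
      obtain rfl := Option.some.inj (hx.symm.trans hy)
      exact hc (hrej.2 hr)

/-- The state of the algorithm: either it has reached a matching no TA has to leave,
or the potential has dropped to `p`. -/
def Reached (I : Inst) (p : ℕ) (s : Mem) : Prop :=
  ∃ μ : I.Matching, Inst.Dominates μ ∧ Holds μ s ∧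
    ((∀ t, ¬ I.Leaves μ t) ∨ Inst.potential μ ≤ p)

theorem Reached.write {p : ℕ} {s : Mem} (h : Reached I p s) {a : ℕ} (ha : 2 ≤ a) (i x : ℕ) :
    Reached I p (s.write a i x) := by
  obtain ⟨μ, hμ, hs, h⟩ := h
  exact ⟨μ, hμ, hs.write ha _ _, h⟩

theorem Reached.input {p : ℕ} {s : Mem} (h : Reached I p s) : s 0 = I.input := by
  obtain ⟨μ, -, hs, -⟩ := h
  exact hs.input

/-- A sweep without a move has tested all TAs against one and the same matching, so nobody has to
leave it; any other sweep lowers the potential. -/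
theorem Reached.round (hI : I.Restricted) {p : ℕ} {s : Mem} (h : Reached I p s) :
    Reached I (p - 1) ((Cmd.rep 2 2 update).run s) := by
  obtain ⟨μ, hμ, hs, h⟩ := h
  have key := Cmd.run_rep (a := 2) (b := 2) (P := update) (s := s)
    (fun j r => ∃ ν : I.Matching, Inst.Dominates ν ∧ Holds ν r ∧
      ((ν = μ ∧ ∀ t : Fin I.m, (t : ℕ) < j → ¬ I.Leaves μ t) ∨
      -- That some TA leaves the starting matching is recorded to exclude the first alternative of
      -- `Reached` for `μ`.
      ((∃ t, I.Leaves μ t) ∧ Inst.potential ν < Inst.potential μ)))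
    (by decide) ⟨μ, hμ, hs.write le_rfl _ _, .inl ⟨rfl, by simp⟩⟩
    (by
      rintro j r hj hr ⟨ν, hν, hr', hcase⟩
      rw [hs.input, Inst.input_m] at hj
      obtain ⟨t, rfl⟩ : ∃ t : Fin I.m, (t : ℕ) = j := ⟨⟨j, hj⟩, rfl⟩
      rcases hr'.exists_update hI hν hr with ⟨hl, hH⟩ | ⟨hl, ν', hν', hlt, hH⟩
      · refine ⟨ν, hν, hH.write le_rfl _ _, ?_⟩
        rcases hcase with ⟨rfl, hno⟩ | hcase
        · left
          refine ⟨rfl, fun t' ht' => ?_⟩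
          rcases Nat.lt_succ_iff_lt_or_eq.1 ht' with h | h
          · exact hno t' h
          · exact Fin.ext h ▸ hl
        · exact .inr hcase
      · refine ⟨ν', hν', hH.write le_rfl _ _, .inr ?_⟩
        rcases hcase with ⟨rfl, hno⟩ | hcase
        · exact ⟨⟨t, hl⟩, hlt⟩
        · exact ⟨hcase.1, hlt.trans hcase.2⟩)
  obtain ⟨ν, hν, hr, hcase⟩ := key
  refine ⟨ν, hν, hr, ?_⟩
  rcases hcase with ⟨rfl, hno⟩ | ⟨⟨t, ht⟩, hlt⟩
  · left
    intro t
    exact hno t (by rw [hs.input, Inst.input_m]; exact t.2)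
  · right
    have := h.resolve_left fun h => h t ht
    omega

/-- Loop bounds are input cells, so the `n * m` sweeps are counted by two nested loops; `j * I.m +
i` of them precede inner pass `i` of outer pass `j`. -/
theorem Reached.run_improve (hI : I.Restricted) {p : ℕ} {s : Mem} (h : Reached I p s) :
    Reached I (p - I.n * I.m) (improve.run s) := by
  have hn : s 0 1 = I.n := by rw [h.input, Inst.input_n]
  have key := Cmd.run_rep (a := 13) (b := 1) (P := .rep 14 2 (.rep 2 2 update)) (s := s)
    (fun j r => Reached I (p - j * I.m) r) (by decide)
    (by simpa using h.write (by omega) _ _)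
    (by
      intro j r hj _ hr
      have hm : r 0 2 = I.m := by rw [hr.input, Inst.input_m]
      refine Reached.write ?_ (by omega) _ _
      have := Cmd.run_rep (a := 14) (b := 2) (P := .rep 2 2 update) (s := r)
        (fun i q => Reached I (p - j * I.m - i) q) (by decide) (hr.write (by omega) _ _)
        (fun i q _ _ hq => by
          rw [Nat.sub_add_eq]
          exact (hq.round hI).write (by omega) _ _)
      rwa [hm, Nat.sub_sub, ← Nat.succ_mul] at this)
  rwa [hn] at key

theorem outputs_encodeMatching {μ : I.Matching} {s : Mem} (h0 : s 1 0 = I.m + 1) (h1 : s 1 1 = 1)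
    (h : ∀ t : Fin I.m, s 1 (t + 2) = code (μ t)) : Outputs s (1 :: I.encodeMatching μ) := by
  intro i hi
  have hlen : (I.encodeMatching μ).length = I.m := by simp [Inst.encodeMatching]
  match i with
  | 0 => simp [h0, hlen]
  | 1 => simp [h1]
  | j + 2 =>
    simp only [List.length_cons, hlen] at hi
    have := h ⟨j, by omega⟩
    simp only at this
    rw [this, List.getD_cons_succ, List.getD_cons_succ, List.getD_eq_getElem?_getD,
      Inst.encodeMatching, List.getElem?_ofFn, dif_pos (by omega)]
    simp only [Option.getD_some]
    cases μ ⟨j, by omega⟩ <;> rfl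

theorem outputs_no {s : Mem} (h0 : s 1 0 = 1) (h1 : s 1 1 = 0) : Outputs s [0] := by
  intro i hi
  match i with
  | 0 => simp [h0]
  | 1 => simp [h1]
  | j + 2 => simp at hi

theorem Holds.outputs_answer {μ : I.Matching} {s : Mem} (h : Holds μ s) :
    (∑ x, I.c x ≤ Inst.matched μ → Outputs (answer.run s) (1 :: I.encodeMatching μ)) ∧
    (¬ ∑ x, I.c x ≤ Inst.matched μ → Outputs (answer.run s) [0]) := by
  have hn : ((assign 9 (.const 0)).run s) 0 1 = I.n := by
    simp [assign, Cmd.run, write_apply, h.input, Inst.input_n]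
  have k1 := Cmd.run_rep (a := 6) (b := 1) (P := assign 9 (add (reg 9) (cap (reg 6))))
    (s := (assign 9 (.const 0)).run s)
    (fun j r => Holds μ r ∧
      r 9 0 = ∑ x : Fin I.n, if (x : ℕ) < j then I.c x else 0) (by decide)
    ⟨(h.run _ (by decide) (by decide)).write (by omega) _ _,
      by simp [assign, Cmd.run, write_apply, Expr.eval]⟩
    (by
      rintro j r hj hr ⟨r0, r9⟩
      rw [hn] at hj
      obtain ⟨x, rfl⟩ : ∃ x : Fin I.n, (x : ℕ) = j := ⟨⟨j, hj⟩, rfl⟩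
      refine ⟨(r0.run _ (by decide) (by decide)).write (by omega) _ _, ?_⟩
      rw [sum_ite_lt_succ, ← r9]
      simp [assign, Cmd.run, write_apply, eval_add, eval_reg, eval_const, eval_cap, r0.input, hr,
        Inst.input_c])
  rw [hn] at k1
  generalize hs₁ : (Cmd.rep 6 1 (assign 9 (add (reg 9) (cap (reg 6))))).run
    ((assign 9 (.const 0)).run s) = s₁ at k1
  obtain ⟨h₁, h9⟩ := k1
  simp only [Fin.is_lt, if_true] at h9
  have hm : s₁ 0 2 = I.m := by rw [h₁.input, Inst.input_m]
  have k2 := Cmd.run_rep (a := 2) (b := 2)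
    (P := .cond (cur (reg 2)) (assign 9 (sub (reg 9) (.const 1))) .skip) (s := s₁)
    (fun j r => Holds μ r ∧ r 9 0 = ∑ x, I.c x -
      ∑ t : Fin I.m, if (t : ℕ) < j then if μ t ≠ none then 1 else 0 else 0) (by decide)
    ⟨h₁.write (by omega) _ _, by simp [write_apply, h9]⟩
    (by
      rintro j r hj hr ⟨r0, r9⟩
      rw [hm] at hj
      obtain ⟨t, rfl⟩ : ∃ t : Fin I.m, (t : ℕ) = j := ⟨⟨j, hj⟩, rfl⟩
      refine ⟨(r0.run _ (by decide) (by decide)).write (by omega) _ _, ?_⟩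
      rw [sum_ite_lt_succ, Nat.sub_add_eq, ← r9]
      simp only [Cmd.run, eval_cur, eval_reg, hr, r0.course, Ne, code_eq_zero_iff]
      by_cases ht : μ t = none <;>
        simp [ht, assign, Cmd.run, write_apply, eval_sub, eval_reg, eval_const])
  rw [hm] at k2
  generalize hs₂ : (Cmd.rep 2 2 (.cond (cur (reg 2)) (assign 9 (sub (reg 9) (.const 1)))
    .skip)).run s₁ = s₂ at k2
  obtain ⟨h₂, h9'⟩ := k2
  simp only [Fin.is_lt, if_true, ← Finset.sum_filter, Finset.sum_const, smul_eq_mul,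
    mul_one] at h9'
  change s₂ 9 0 = _ - Inst.matched μ at h9'
  have hrun : answer.run s = (Cmd.cond (reg 9)
      (.seq (assign 1 (.const 1)) (.set 1 (.const 1) (.const 0)))
      (.seq (assign 1 (add (.get 0 (.const 2)) (.const 1))) (.set 1 (.const 1) (.const 1)))).run
      s₂ := by
    rw [← hs₂, ← hs₁]; rfl
  rw [hrun, Cmd.run, eval_reg, h9']
  constructor
  · intro hle
    rw [if_neg (by omega)]
    apply outputs_encodeMatching
    · simp [Cmd.run, assign, write_apply, eval_add, eval_get, eval_const, h₂.input, Inst.input_m]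
    · simp [Cmd.run, write_apply, eval_const]
    · intro t
      simp [Cmd.run, assign, write_apply, eval_const, h₂.course]
  · intro hlt
    rw [if_pos (by omega)]
    apply outputs_no <;> simp [Cmd.run, assign, write_apply, eval_const]

/-- The potential starts at no more than `n * m`, so after all sweeps either nobody has to leave or
it is `0`, which also means that nobody has to. The count of employed TAs then decides existence. -/
theorem outputs_main (hI : I.Restricted) :
    (∃ μ, I.Fair μ ∧ Outputs (main.run (load I.encode)) (1 :: I.encodeMatching μ)) ∨
    ((¬ ∃ μ, I.Fair μ) ∧ Outputs (main.run (load I.encode)) [0]) := by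
  obtain ⟨μ, hμ, hs⟩ := exists_holds_init (I := I) (s := load I.encode) rfl
  obtain ⟨ν, hν, hr, hcase⟩ := Reached.run_improve hI
    (⟨μ, hμ, hs, .inr (Inst.potential_le μ)⟩ : Reached I (I.n * I.m) _)
  have hno : ∀ t, ¬ I.Leaves ν t := by
    rcases hcase with h | h
    · exact h
    · exact Inst.not_leaves_of_potential hν (by omega)
  by_cases hc : ∑ x, I.c x ≤ Inst.matched ν
  · exact .inl ⟨ν, hν.fair hno hc, hr.outputs_answer.1 hc⟩
  · exact .inr ⟨fun ⟨ξ, hξ⟩ => hc (hξ.sum_c_le_matched hν), hr.outputs_answer.2 hc⟩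

end Alg
end MEFE

theorem theorem8 :
    RAM.PolyTimeSolvable MEFE.Inst.encode MEFE.Inst.encodeMatching
      MEFE.Inst.Restricted MEFE.Inst.Fair := by
  obtain ⟨p, hp⟩ := MEFE.Alg.main_tame.exists_exec_load
  refine ⟨MEFE.Alg.main.toProg, p, fun I hI => ?_⟩
  obtain ⟨c, hc, hex⟩ := hp I.encode I.input_n_le I.input_m_le
  rcases MEFE.Alg.outputs_main hI with ⟨μ, hμ, hout⟩ | ⟨hno, hout⟩
  · exact .inl ⟨μ, hμ, c, _, hex, hc, hout⟩
  · exact .inr ⟨hno, c, _, hex, hc, hout⟩
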